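/- Let $J^2=J^2(\mathbb R,\mathbb R)$ with coordinates $(x,y,y_1,y_2)$, let $J^{2,0}=J^2\times\mathbb R$ with coordinates $(x,y,y_1,y_2,z)$, and let $\pi\colon J^{2,0}\to J^2$ be the projection forgetting $z$. Let $U\subseteq J^{2,0}$ be a non-empty connected open set on which $y_2\neq 0$, and let $D$ be the distribution of the Monge equation $z'=y+(y'')^{1/3}$ (real cube root), i.e. the rank 2 distribution on $U$ spanned by $$\partial_{y_2},\qquad \partial_x+y_1\partial_y+y_2\partial_{y_1}+\bigl(y+y_2^{1/3}\bigr)\partial_z .$$ Then $D$ is generic: for every local frame $X_1,X_2$ of $D$ the fields $X_1$, $X_2$, $X_3=[X_1,X_2]$, $[X_1,X_3]$, $[X_2,X_3]$ form a local frame of the tangent bundle. Let $\mathfrak s$ be the Lie algebra of all smooth vector fields $S$ on $U$ such that $[S,X]$ is a section of $D$ for every local section $X$ of $D$. Then: 1. The restrictions to $U$ of the following six vector fields form a basis of $\mathfrak s$ over $\mathbb R$: $$\begin{aligned} S_1&=x\partial_y+\partial_{y_1}+\tfrac12x^2\partial_z, & S_2&=x\partial_x-y\partial_y-2y_1\partial_{y_1}-3y_2\partial_{y_2},\\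 S_3&=y\partial_x-y_1^2\partial_{y_1}-3y_1y_2\partial_{y_2}+\tfrac12y^2\partial_z, & S_4&=\partial_x,\\ S_5&=\partial_y+x\partial_z, & S_6&=\partial_z . \end{aligned}$$ 2. $\mathfrak s$ is isomorphic to $\mathfrak{sl}(2,\mathbb R)\ltimes\mathfrak n_3$, where $\mathfrak n_3$ is the 3-dimensional Heisenberg algebra (strictly upper triangular $3\times3$ matrices), on which $\mathfrak{sl}(2,\mathbb R)$ acts by derivations: by the standard representation on the pair of entries $(1,2)$, $(2,3)$, and by zero on the centre. 3. $\mathfrak s$ preserves the fibration $\pi$: for $S\in\mathfrak s$ the bracket of $S$ with any local vector field tangent to the fibres of $\pi$ is tangent to the fibres, and $S$ projects to a smooth vector field $\pi_*S$ on the open set $\pi(U)$. 4. The map $\pi_*$ is a homomorphism of Lie algebras from $\mathfrak s$ to the smooth vector fields on $\pi(U)$. Its kernel is one-dimensional, is equal to the centre of $\mathfrak s$, and is spanned by $S_6$. Its image is 5-dimensional and consists exactly of the restrictions to $\pi(U)$ of the prolongations of the equiaffine vector fields $p\mapsto Ap+b$ on the plane ($A\in\mathfrak{sl}(2,\mathbb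 R)$, $b\in\mathbb R^2$). Here the prolongation to $J^2$ of $\xi\partial_x+\eta\partial_y$ is $\xi\partial_x+\eta\partial_y+\eta_1\partial_{y_1}+\eta_2\partial_{y_2}$ with $\eta_1=D_x\eta-y_1D_x\xi$, $\eta_2=D_x\eta_1-y_2D_x\xi$, $D_x=\partial_x+y_1\partial_y+y_2\partial_{y_1}$. -/

import Mathlib

open Set TopologicalSpace VectorField
open scoped ContDiff

noncomputable section

namespace Monge

section VectorFields

variable {E : Type*} [NormedAddCommGroup E] [NormedSpace ℝ E]

/-- A smooth vector field on the open subset `U` of the vector space `E`. It is represented by its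
extension by zero to all of `E`, so that two vector fields are equal iff they agree on `U`. -/
@[ext] structure SmoothVectorField (U : Opens E) where
  toFun : E → E
  smooth' : ContDiffOn ℝ ∞ toFun U
  zero_off' : ∀ p ∉ U, toFun p = 0

namespace SmoothVectorField

variable {U : Opens E}

instance : CoeFun (SmoothVectorField U) (fun _ => E → E) := ⟨toFun⟩

theorem toFun_injective :
    Function.Injective (fun X : SmoothVectorField U => (X : E → E)) :=
  fun _ _ h => SmoothVectorField.ext h

instance : Zero (SmoothVectorField U) := ⟨⟨0, contDiffOn_const, fun _ _ => rfl⟩⟩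

instance : Add (SmoothVectorField U) :=
  ⟨fun X Y => ⟨X.toFun + Y.toFun, X.smooth'.add Y.smooth', fun p hp => by
    simp [X.zero_off' p hp, Y.zero_off' p hp]⟩⟩

instance : Neg (SmoothVectorField U) :=
  ⟨fun X => ⟨-X.toFun, X.smooth'.neg, fun p hp => by simp [X.zero_off' p hp]⟩⟩

instance : Sub (SmoothVectorField U) :=
  ⟨fun X Y => ⟨X.toFun - Y.toFun, X.smooth'.sub Y.smooth', fun p hp => by
    simp [X.zero_off' p hp, Y.zero_off' p hp]⟩⟩

instance {R : Type*} [Monoid R] [DistribMulAction R ℝ] [DistribMulAction R E]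
    [IsScalarTower R ℝ E] : SMul R (SmoothVectorField U) :=
  ⟨fun c X => ⟨fun p => c • X.toFun p, by
    have h : (fun p => c • X.toFun p) = fun p => (c • (1 : ℝ)) • X.toFun p := by
      funext p; rw [smul_assoc, one_smul]
    rw [h]
    exact X.smooth'.const_smul (c • (1 : ℝ)), fun p hp => by simp [X.zero_off' p hp]⟩⟩

instance : AddCommGroup (SmoothVectorField U) :=
  toFun_injective.addCommGroup _ rfl (fun _ _ => rfl) (fun _ => rfl) (fun _ _ => rfl)
    (fun _ _ => rfl) (fun _ _ => rfl)

/-- Evaluation as an additive homomorphism into the space of all maps `E → E`. -/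
def coeAddHom : SmoothVectorField U →+ (E → E) where
  toFun := toFun
  map_zero' := rfl
  map_add' _ _ := rfl

instance : Module ℝ (SmoothVectorField U) :=
  toFun_injective.module ℝ coeAddHom (fun _ _ => rfl)

@[simp] theorem zero_apply (p : E) : (0 : SmoothVectorField U) p = 0 := rfl
@[simp] theorem add_apply (X Y : SmoothVectorField U) (p : E) : (X + Y) p = X p + Y p := rfl
@[simp] theorem neg_apply (X : SmoothVectorField U) (p : E) : (-X) p = -X p := rfl
@[simp] theorem sub_apply (X Y : SmoothVectorField U) (p : E) : (X - Y) p = X p - Y p := rfl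
@[simp] theorem smul_apply (c : ℝ) (X : SmoothVectorField U) (p : E) :
    (c • X) p = c • X p := rfl

theorem ext_on {X Y : SmoothVectorField U} (h : ∀ p ∈ U, X p = Y p) : X = Y := by
  ext1
  funext p
  by_cases hp : p ∈ U
  · exact h p hp
  · rw [X.zero_off' p hp, Y.zero_off' p hp]

end SmoothVectorField

theorem contDiffOn_lieBracket {X Y : E → E} {V : Opens E} (hX : ContDiffOn ℝ ∞ X V)
    (hY : ContDiffOn ℝ ∞ Y V) : ContDiffOn ℝ ∞ (lieBracket ℝ X Y) V := fun p hp =>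
  (ContDiffAt.lieBracket_vectorField (hX.contDiffAt (V.isOpen.mem_nhds hp))
    (hY.contDiffAt (V.isOpen.mem_nhds hp)) le_rfl).contDiffWithinAt

/-- The restriction to `U` of a smooth vector field on the whole space. -/
def restrict (X : E → E) (hX : ContDiff ℝ ∞ X) (U : Opens E) : SmoothVectorField U where
  toFun := (U : Set E).indicator X
  smooth' := hX.contDiffOn.congr fun _ hp => indicator_of_mem hp X
  zero_off' _ hp := indicator_of_notMem hp X

namespace SmoothVectorField

variable {U : Opens E}

theorem contDiffAt (X : SmoothVectorField U) {p : E} (hp : p ∈ U) : ContDiffAt ℝ ∞ X p :=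
  X.smooth'.contDiffAt (U.isOpen.mem_nhds hp)

theorem differentiableAt (X : SmoothVectorField U) {p : E} (hp : p ∈ U) :
    DifferentiableAt ℝ X p :=
  (X.contDiffAt hp).differentiableAt (by simp)

/-- The Lie bracket `[X, Y] = X Y - Y X` of smooth vector fields on `U`. -/
instance : Bracket (SmoothVectorField U) (SmoothVectorField U) :=
  ⟨fun X Y =>
    { toFun := (U : Set E).indicator (lieBracket ℝ X Y)
      smooth' := (contDiffOn_lieBracket X.smooth' Y.smooth').congr
        fun _ hp => indicator_of_mem hp _
      zero_off' := fun _ hp => indicator_of_notMem hp _ }⟩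

theorem bracket_apply (X Y : SmoothVectorField U) {p : E} (hp : p ∈ U) :
    ⁅X, Y⁆ p = lieBracket ℝ X Y p := indicator_of_mem (s := (U : Set E)) hp _

theorem bracket_eventuallyEq (X Y : SmoothVectorField U) {p : E} (hp : p ∈ U) :
    (⁅X, Y⁆ : SmoothVectorField U).toFun =ᶠ[nhds p] lieBracket ℝ X Y :=
  Filter.eventuallyEq_of_mem (U.isOpen.mem_nhds hp) fun _ hq => bracket_apply X Y hq

theorem jacobi {X Y Z : E → E} {p : E} (hX : ContDiffAt ℝ ∞ X p) (hY : ContDiffAt ℝ ∞ Y p)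
    (hZ : ContDiffAt ℝ ∞ Z p) :
    lieBracket ℝ X (lieBracket ℝ Y Z) p =
      lieBracket ℝ (lieBracket ℝ X Y) Z p + lieBracket ℝ Y (lieBracket ℝ X Z) p :=
  leibniz_identity_lieBracket (n := ∞) (by
    rw [minSmoothness_of_isRCLikeNormedField]
    exact WithTop.coe_le_coe.2 (le_top : (2 : ℕ∞) ≤ ⊤)) hX hY hZ

instance : LieRing (SmoothVectorField U) where
  add_lie X Y Z := ext_on fun p hp => by
    rw [add_apply, bracket_apply _ _ hp, bracket_apply _ _ hp, bracket_apply _ _ hp]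
    exact lieBracket_add_left (X.differentiableAt hp) (Y.differentiableAt hp)
  lie_add X Y Z := ext_on fun p hp => by
    rw [add_apply, bracket_apply _ _ hp, bracket_apply _ _ hp, bracket_apply _ _ hp]
    exact lieBracket_add_right (Y.differentiableAt hp) (Z.differentiableAt hp)
  lie_self X := ext_on fun p hp => by
    rw [bracket_apply _ _ hp, lieBracket_self]; rfl
  leibniz_lie X Y Z := ext_on fun p hp => by
    rw [add_apply, bracket_apply _ _ hp, bracket_apply _ _ hp, bracket_apply _ _ hp,
      (Filter.EventuallyEq.refl _ _).lieBracket_vectorField_eq (bracket_eventuallyEq Y Z hp),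
      (bracket_eventuallyEq X Y hp).lieBracket_vectorField_eq (Filter.EventuallyEq.refl _ _),
      (Filter.EventuallyEq.refl _ _).lieBracket_vectorField_eq (bracket_eventuallyEq X Z hp)]
    exact jacobi (X.contDiffAt hp) (Y.contDiffAt hp) (Z.contDiffAt hp)

instance : LieAlgebra ℝ (SmoothVectorField U) where
  lie_smul c X Y := ext_on fun p hp => by
    rw [smul_apply, bracket_apply _ _ hp, bracket_apply _ _ hp]
    exact lieBracket_const_smul_right (Y.differentiableAt hp)

end SmoothVectorField

/-- `S` is an infinitesimal symmetry of the distribution `D` over the open set `U`: the bracket of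
`S` with every local section of `D` is again a section of `D`. -/
def IsInfinitesimalSymmetry (D : E → Submodule ℝ E) (U : Opens E) (S : E → E) : Prop :=
  ∀ V : Opens E, V ≤ U → ∀ X : E → E, ContDiffOn ℝ ∞ X V → (∀ p ∈ V, X p ∈ D p) →
    ∀ p ∈ V, lieBracket ℝ S X p ∈ D p

/-- The Lie algebra of all infinitesimal symmetries, defined and smooth on `U`, of `D`. -/
def symmetryAlgebra (D : E → Submodule ℝ E) (U : Opens E) :
    LieSubalgebra ℝ (SmoothVectorField U) where
  carrier := {S | IsInfinitesimalSymmetry D U S}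
  zero_mem' := fun _ _ X _ _ p _ => by
    have h : lieBracket ℝ (0 : SmoothVectorField U).toFun X p = 0 :=
      congrFun (lieBracket_zero_left (𝕜 := ℝ) (W := X)) p
    rw [h]; exact (D p).zero_mem
  add_mem' := fun {S T} hS hT V hV X hX hXD p hp => by
    have hXp : DifferentiableAt ℝ X p :=
      (hX.contDiffAt (V.isOpen.mem_nhds hp)).differentiableAt (by simp)
    have h : lieBracket ℝ (S + T).toFun X p = lieBracket ℝ S X p + lieBracket ℝ T X p :=
      lieBracket_add_left (S.differentiableAt (hV hp)) (T.differentiableAt (hV hp))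
    rw [h]
    exact (D p).add_mem (hS V hV X hX hXD p hp) (hT V hV X hX hXD p hp)
  smul_mem' := fun c S hS V hV X hX hXD p hp => by
    have h : lieBracket ℝ (c • S).toFun X p = c • lieBracket ℝ S X p :=
      lieBracket_const_smul_left (S.differentiableAt (hV hp))
    rw [h]
    exact (D p).smul_mem c (hS V hV X hX hXD p hp)
  lie_mem' := fun {S T} hS hT V hV X hX hXD p hp => by
    have hX' := hX.contDiffAt (V.isOpen.mem_nhds hp)
    have hT' : ContDiffOn ℝ ∞ T V := T.smooth'.mono hV
    have hS' : ContDiffOn ℝ ∞ S V := S.smooth'.mono hV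
    have h1 := hS V hV _ (contDiffOn_lieBracket hT' hX) (hT V hV X hX hXD) p hp
    have h2 := hT V hV _ (contDiffOn_lieBracket hS' hX) (hS V hV X hX hXD) p hp
    have h3 := SmoothVectorField.jacobi (S.contDiffAt (hV hp)) (T.contDiffAt (hV hp)) hX'
    rw [(SmoothVectorField.bracket_eventuallyEq S T (hV hp)).lieBracket_vectorField_eq
      (Filter.EventuallyEq.refl _ _), ← sub_eq_of_eq_add h3]
    exact (D p).sub_mem h1 h2

/-- `X₁, X₂` is a smooth frame over `V` of the rank 2 distribution `D`. -/
def IsLocalFrame (D : E → Submodule ℝ E) (V : Opens E) (X₁ X₂ : E → E) : Prop :=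
  ContDiffOn ℝ ∞ X₁ V ∧ ContDiffOn ℝ ∞ X₂ V ∧
    ∀ p ∈ V, LinearIndependent ℝ ![X₁ p, X₂ p] ∧ Submodule.span ℝ {X₁ p, X₂ p} = D p

/-- `D` is, over `U`, a smooth rank 2 distribution, and for any local frame `X₁, X₂` the fields
`X₁, X₂, X₃ = [X₁, X₂], X₄ = [X₁, X₃], X₅ = [X₂, X₃]` form a frame of the tangent bundle. -/
def IsGeneric (D : E → Submodule ℝ E) (U : Opens E) : Prop :=
  (∀ p ∈ U, ∃ V : Opens E, p ∈ V ∧ V ≤ U ∧ ∃ X₁ X₂ : E → E, IsLocalFrame D V X₁ X₂) ∧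
  ∀ V : Opens E, V ≤ U → ∀ X₁ X₂ : E → E, IsLocalFrame D V X₁ X₂ → ∀ p ∈ V,
    LinearIndependent ℝ ![X₁ p, X₂ p, lieBracket ℝ X₁ X₂ p,
      lieBracket ℝ X₁ (lieBracket ℝ X₁ X₂) p, lieBracket ℝ X₂ (lieBracket ℝ X₁ X₂) p] ∧
    Submodule.span ℝ (range ![X₁ p, X₂ p, lieBracket ℝ X₁ X₂ p,
      lieBracket ℝ X₁ (lieBracket ℝ X₁ X₂) p, lieBracket ℝ X₂ (lieBracket ℝ X₁ X₂) p]) = ⊤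

end VectorFields

/-- The plane, with coordinates `(x, y) = (p 0, p 1)`. -/
abbrev Plane : Type := Fin 2 → ℝ

/-- The jet space `J²(ℝ, ℝ)`, with coordinates `(x, y, y₁, y₂) = (q 0, q 1, q 2, q 3)`. -/
abbrev J2 : Type := Fin 4 → ℝ

/-- The mixed jet space `J^{2,0} = J²(ℝ, ℝ) × ℝ`, with coordinates
`(x, y, y₁, y₂, z) = (p 0, p 1, p 2, p 3, p 4)`. -/
abbrev J20 : Type := Fin 5 → ℝ

/-- The projection `J^{2,0} → J²` that forgets `z`. -/
def proj : J20 →ₗ[ℝ] J2 where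
  toFun p := ![p 0, p 1, p 2, p 3]
  map_add' p q := by ext i; fin_cases i <;> rfl
  map_smul' c p := by ext i; fin_cases i <;> rfl

theorem proj_surjective : Function.Surjective proj := fun q =>
  ⟨![q 0, q 1, q 2, q 3, 0], by ext i; fin_cases i <;> rfl⟩

/-- The image in `J²` of an open subset of `J^{2,0}`. -/
def projOpens (U : Opens J20) : Opens J2 :=
  ⟨proj '' U, proj.isOpenMap_of_finiteDimensional proj_surjective U U.isOpen⟩

/-- The tangent spaces of the fibres of `J^{2,0} → J²`. -/
def vertical : J20 → Submodule ℝ J20 := fun _ => LinearMap.ker proj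

/-- The real cube root. -/
def cbrt (t : ℝ) : ℝ := SignType.sign t * |t| ^ (1 / 3 : ℝ)

theorem cbrt_pow_three (t : ℝ) : cbrt t ^ 3 = t := by
  have h : (|t| ^ (1 / 3 : ℝ)) ^ 3 = |t| := by
    rw [← Real.rpow_natCast, ← Real.rpow_mul (abs_nonneg t)]
    norm_num
  rw [cbrt, mul_pow, h]
  rcases lt_trichotomy t 0 with ht | rfl | ht
  · simp [sign_neg ht, abs_of_neg ht]
    ring
  · simp
  · simp [sign_pos ht, abs_of_pos ht]

/-- The right-hand side `F = y + y₂^{1/3}` of the Monge equation `z' = y + (y'')^{1/3}`. -/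
def mongeF (p : J20) : ℝ := p 1 + cbrt (p 3)

/-- The distribution of the Monge equation `z' = y + (y'')^{1/3}`, spanned by `∂/∂y₂` and
`∂/∂x + y₁ ∂/∂y + y₂ ∂/∂y₁ + F ∂/∂z`. -/
def mongeDistribution (p : J20) : Submodule ℝ J20 :=
  Submodule.span ℝ {![0, 0, 0, 1, 0], ![1, p 2, p 3, 0, mongeF p]}

/-- The six vector fields `S₁, …, S₆` on `J^{2,0}`. -/
def genField : Fin 6 → J20 → J20 :=
  ![fun p => ![0, p 0, 1, 0, (1 / 2) * p 0 ^ 2],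
    fun p => ![p 0, -p 1, -2 * p 2, -3 * p 3, 0],
    fun p => ![p 1, 0, -p 2 ^ 2, -3 * p 2 * p 3, (1 / 2) * p 1 ^ 2],
    fun _ => ![1, 0, 0, 0, 0],
    fun p => ![0, 1, 0, 0, p 0],
    fun _ => ![0, 0, 0, 0, 1]]

theorem contDiff_genField (i : Fin 6) : ContDiff ℝ ∞ (genField i) := by
  rw [contDiff_pi]
  intro j
  fin_cases i <;> fin_cases j <;> simp [genField] <;> fun_prop

/-- The restrictions of `S₁, …, S₆` to `U`. -/
def S (U : Opens J20) (i : Fin 6) : SmoothVectorField U :=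
  restrict (genField i) (contDiff_genField i) U

section SemidirectSum

/- Matrices form a Lie algebra under the commutator. -/
attribute [local instance] LieRing.ofAssociativeRing

/-- The Lie algebra `n₃` of strictly upper triangular `3 × 3` matrices, that is, the Heisenberg
algebra of dimension 3. -/
def n3 : LieSubalgebra ℝ (Matrix (Fin 3) (Fin 3) ℝ) where
  carrier := {A | ∀ i j, j ≤ i → A i j = 0}
  zero_mem' _ _ _ := rfl
  add_mem' {A B} hA hB i j h := by simp [hA i j h, hB i j h]
  smul_mem' c A hA i j h := by simp [hA i j h]
  lie_mem' {A B} hA hB i j h := by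
    rw [Ring.lie_def, Matrix.sub_apply, Matrix.mul_apply, Matrix.mul_apply,
      Finset.sum_eq_zero, Finset.sum_eq_zero, sub_zero]
    · intro k _
      rcases le_total k i with hk | hk
      · simp [hB i k hk]
      · simp [hA k j (h.trans hk)]
    · intro k _
      rcases le_total k i with hk | hk
      · simp [hA i k hk]
      · simp [hB k j (h.trans hk)]

/-- The matrix in `n₃` with entries `p` at `(0, 1)`, `q` at `(1, 2)` and `r` at `(0, 2)`. -/
def n3Mk (p q r : ℝ) : n3 :=
  ⟨!![0, p, r; 0, 0, q; 0, 0, 0], by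
    intro i j h
    fin_cases i <;> fin_cases j <;> first | rfl | exact absurd h (by decide)⟩

theorem n3_ext {A B : n3} (h1 : A.1 0 1 = B.1 0 1) (h2 : A.1 1 2 = B.1 1 2)
    (h3 : A.1 0 2 = B.1 0 2) : A = B := by
  apply Subtype.ext
  ext i j
  by_cases hij : j ≤ i
  · rw [A.2 i j hij, B.2 i j hij]
  · fin_cases i <;> fin_cases j <;> first | assumption | exact absurd (by decide) hij

theorem n3_bracket (A B : n3) :
    ⁅A, B⁆ = n3Mk 0 0 (A.1 0 1 * B.1 1 2 - B.1 0 1 * A.1 1 2) := by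
  have h (C : n3) (i j : Fin 3) (hij : j ≤ i) : C.1 i j = 0 := C.2 i j hij
  have hb (i j : Fin 3) : (⁅A, B⁆ : n3).1 i j = (A.1 * B.1) i j - (B.1 * A.1) i j := rfl
  apply n3_ext <;> rw [hb, Matrix.mul_apply, Matrix.mul_apply, Fin.sum_univ_three,
    Fin.sum_univ_three]
  · rw [h A 0 0 le_rfl, h B 0 0 le_rfl, h A 1 1 le_rfl, h B 1 1 le_rfl, h A 2 1 (by decide),
      h B 2 1 (by decide)]
    simp [n3Mk]
  · rw [h A 1 0 (by decide), h B 1 0 (by decide), h A 1 1 le_rfl, h B 1 1 le_rfl,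
      h A 2 2 le_rfl, h B 2 2 le_rfl]
    simp [n3Mk]
  · rw [h A 0 0 le_rfl, h B 0 0 le_rfl, h A 2 2 le_rfl, h B 2 2 le_rfl]
    simp [n3Mk]

/-- The derivation of `n₃` given by `a ∈ sl(2)`: it acts by the standard two-dimensional
representation on the entries `(0, 1)` and `(1, 2)`, and by zero on the centre (entry `(0, 2)`). -/
def sl2Derivation (a : LieAlgebra.SpecialLinear.sl (Fin 2) ℝ) : LieDerivation ℝ n3 n3 where
  toFun A := n3Mk (a.1 0 0 * A.1 0 1 + a.1 0 1 * A.1 1 2)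
    (a.1 1 0 * A.1 0 1 + a.1 1 1 * A.1 1 2) 0
  map_add' A B := by
    apply n3_ext <;> simp [n3Mk] <;> ring
  map_smul' c A := by
    apply n3_ext <;> simp [n3Mk] <;> ring
  leibniz' A B := by
    have ht : a.1 0 0 + a.1 1 1 = 0 := by
      have := LinearMap.mem_ker.1 a.2
      simpa [Matrix.trace_fin_two] using this
    have ha : a.1 1 1 = -a.1 0 0 := by linarith
    simp only [LinearMap.coe_mk, AddHom.coe_mk, n3_bracket]
    apply n3_ext <;> simp [n3Mk, ha] <;> ring

/-- The action of `sl(2)` on `n₃` by derivations that defines `sl(2) ⋉ n₃`. -/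
def sl2Action : LieAlgebra.SpecialLinear.sl (Fin 2) ℝ →ₗ⁅ℝ⁆ LieDerivation ℝ n3 n3 where
  toFun := sl2Derivation
  map_add' a b := by
    refine LieDerivation.ext fun A => ?_
    apply n3_ext <;> simp [sl2Derivation, n3Mk] <;> ring
  map_smul' c a := by
    refine LieDerivation.ext fun A => ?_
    apply n3_ext <;> simp [sl2Derivation, n3Mk] <;> ring
  map_lie' {a b} := by
    have hab : (⁅a, b⁆ : LieAlgebra.SpecialLinear.sl (Fin 2) ℝ).1 = a.1 * b.1 - b.1 * a.1 := rfl
    refine LieDerivation.ext fun A => ?_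
    rw [LieDerivation.commutator_apply]
    apply n3_ext <;>
      simp [sl2Derivation, n3Mk, hab, Matrix.mul_apply, Fin.sum_univ_two] <;> ring

/-- The semidirect sum `sl(2) ⋉ n₃`. -/
abbrev Sl2N3 : Type :=
  LieAlgebra.SemiDirectSum n3 (LieAlgebra.SpecialLinear.sl (Fin 2) ℝ) sl2Action

end SemidirectSum

/-- The equiaffine Lie algebra in its standard action on the plane: the vector fields
`p ↦ A p + b` with `tr A = 0`. -/
def equiaffine : Set (Plane → Plane) :=
  {v | ∃ (A : Matrix (Fin 2) (Fin 2) ℝ) (b : Plane), A.trace = 0 ∧ ∀ p, v p = A.mulVec p + b}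

/-- The total derivative `D_x f = f_x + y₁ f_y + y₂ f_{y₁}`, for functions on `J²` that do not
depend on `y₂`. -/
def totalDeriv (f : J2 → ℝ) (q : J2) : ℝ := fderiv ℝ f q ![1, q 2, q 3, 0]

/-- The prolongation to `J²` of the vector field `v = ξ ∂/∂x + η ∂/∂y` on the plane:
`ξ ∂/∂x + η ∂/∂y + η₁ ∂/∂y₁ + η₂ ∂/∂y₂` with `η₁ = D_x η - y₁ D_x ξ` and
`η₂ = D_x η₁ - y₂ D_x ξ`. -/
def prolongation (v : Plane → Plane) : J2 → J2 :=
  let ξ : J2 → ℝ := fun q => v ![q 0, q 1] 0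
  let η : J2 → ℝ := fun q => v ![q 0, q 1] 1
  let η₁ : J2 → ℝ := fun q => totalDeriv η q - q 2 * totalDeriv ξ q
  let η₂ : J2 → ℝ := fun q => totalDeriv η₁ q - q 3 * totalDeriv ξ q
  fun q => ![ξ q, η q, η₁ q, η₂ q]

end Monge

end

/-! In the coordinate r = y₂^{1/3}, with p = y₁, the problem becomes polynomial: ∂_r = 3r²∂_{y₂},
and the distribution is spanned by ∂_r and X = D + r³∂_p + r∂_z, where D = ∂_x + p∂_y + y∂_z. For S
with components (a, b, c, e, f) the symmetry condition amounts to six scalar equations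
(`isInfinitesimalSymmetry_iff_determining`). Written in u = b - pa, w = c - r³a, g = f - (y + r)a,
the values on S of the forms annihilating the distribution, they read u_r = 0, w_r = -3r²a, g_r =
-a, w = Xu, e = Xw and 3r²Xg = 3r²u + e. Comparing w_r with (Xu)_r expresses a through u, and g_r =
-a then integrates to g = r u_p - u_z/(3r) + h with h_r = 0. The last equation becomes polynomial in
r with coefficients free of r, so it splits (`split_determining`). Commuting derivatives in the
split system gives h_p = h_z = 0, u = Dh and D³h = 0 (`solve_split`); as D³h is a cubic in p, all
third derivatives of h in x and y vanish (`third_derivatives`).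

Hence h is a quadratic polynomial in x, y, and S lifts the Hamiltonian field -h_y∂_x + h_x∂_y of the
plane. Such h form a space of dimension 6; their Hamiltonian fields are the equiaffine ones, and
constant h gives S₆. Once the symmetries are identified with coefficient vectors in ℝ⁶
(`mem_symmetryAlgebra_iff`, `lie_combS`), the isomorphism type, the centre, the projection and its
kernel and image are read off from structure constants and explicit polynomials.

Genericity is separate: modulo the distribution, brackets of sections are tensorial. With Y =
[∂_{y₂}, X], a frame with coefficient determinant Δ has first bracket ΔY, and modulo Y its second
brackets are Δ times an invertible linear image of the frame, because (y₂^{1/3})'' ≠ 0. -/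

open Set TopologicalSpace VectorField
open scoped ContDiff

noncomputable section

namespace Monge

/-! ### Solving the determining equations in a differential algebra -/

section DifferentialAlgebra

variable {A : Type*} [CommRing A] [Algebra ℝ A]

/-- A polynomial in `t` whose coefficients are constants of a derivation `δ` with `δ t = 1`
vanishes only if its coefficients do. -/
theorem coeff_eq_zero_of_sum_eq_zero (δ : Derivation ℝ A A) {t : A} (ht : δ t = 1) (n : ℕ) :
    ∀ c : ℕ → A, (∀ i, δ (c i) = 0) → ∑ i ∈ Finset.range (n + 1), c i * t ^ i = 0 →
      ∀ i ≤ n, c i = 0 := by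
  induction n with
  | zero =>
    intro c _ h i hi
    obtain rfl : i = 0 := by omega
    simpa using h
  | succ n ih =>
    intro c hc h
    -- Applying δ lowers the degree: the new coefficients (i + 1) c_{i+1} are again constants, and i
    -- + 1 is invertible over ℝ.
    have h1 := congrArg δ h
    rw [Finset.sum_range_succ', map_add, map_sum, map_zero] at h1
    have h2 : ∑ i ∈ Finset.range (n + 1), (((i : ℝ) + 1) • c (i + 1)) * t ^ i = 0 := by
      rw [← h1]
      simp only [Derivation.leibniz, Derivation.leibniz_pow, hc, ht, add_zero,
        pow_zero, Nat.add_sub_cancel, smul_eq_mul, mul_one]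
      simp only [mul_zero, add_zero]
      refine Finset.sum_congr rfl fun i _ => ?_
      rw [show ((i : ℝ) + 1) = ((i + 1 : ℕ) : ℝ) by push_cast; rfl, Nat.cast_smul_eq_nsmul,
        smul_mul_assoc, mul_smul_comm]
    have h3 := ih _ (fun i => by rw [Derivation.map_smul, hc, smul_zero]) h2
    have h4 : ∀ i ≤ n, c (i + 1) = 0 := fun i hi =>
      (smul_eq_zero_iff_right (by positivity : ((i : ℝ) + 1) ≠ 0)).1 (h3 i hi)
    have h5 : c 0 = 0 := by
      rw [Finset.sum_range_succ', Finset.sum_eq_zero] at h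
      · simpa using h
      · intro i hi
        rw [h4 i (by simpa [Nat.lt_succ_iff] using hi), zero_mul]
    intro i hi
    cases i with
    | zero => exact h5
    | succ i => exact h4 i (by omega)

variable (A) in
/-- An algebra with five commuting derivations and coordinates `x, y, p, r, z`, in which `r` is
invertible. It models functions on `J^{2,0}` with `p = y₁` and `r = y₂^{1/3}`. -/
structure JetDerivations where
  dx : Derivation ℝ A A
  dy : Derivation ℝ A A
  dp : Derivation ℝ A A
  dr : Derivation ℝ A A
  dz : Derivation ℝ A A
  x : A
  y : A
  p : A
  r : A
  s : A
  r_mul_s : r * s = 1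
  dy_dx (f : A) : dy (dx f) = dx (dy f)
  dp_dx (f : A) : dp (dx f) = dx (dp f)
  dr_dx (f : A) : dr (dx f) = dx (dr f)
  dz_dx (f : A) : dz (dx f) = dx (dz f)
  dp_dy (f : A) : dp (dy f) = dy (dp f)
  dr_dy (f : A) : dr (dy f) = dy (dr f)
  dz_dy (f : A) : dz (dy f) = dy (dz f)
  dr_dp (f : A) : dr (dp f) = dp (dr f)
  dz_dp (f : A) : dz (dp f) = dp (dz f)
  dr_dz (f : A) : dr (dz f) = dz (dr f)
  dx_x : dx x = 1
  dy_x : dy x = 0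
  dp_x : dp x = 0
  dr_x : dr x = 0
  dz_x : dz x = 0
  dx_y : dx y = 0
  dy_y : dy y = 1
  dp_y : dp y = 0
  dr_y : dr y = 0
  dz_y : dz y = 0
  dx_p : dx p = 0
  dy_p : dy p = 0
  dp_p : dp p = 1
  dr_p : dr p = 0
  dz_p : dz p = 0
  dx_r : dx r = 0
  dy_r : dy r = 0
  dp_r : dp r = 0
  dr_r : dr r = 1
  dz_r : dz r = 0

namespace JetDerivations

variable (J : JetDerivations A)

attribute [simp] dx_x dy_x dp_x dr_x dz_x dx_y dy_y dp_y dr_y dz_y dx_p dy_p dp_p dr_p dz_p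
  dx_r dy_r dp_r dr_r dz_r

/-- The operator `∂/∂x + p ∂/∂y + y ∂/∂z`. -/
def D : Derivation ℝ A A := J.dx + J.p • J.dy + J.y • J.dz

/-- The total derivative `∂/∂x + p ∂/∂y + r³ ∂/∂p + (y + r) ∂/∂z`. -/
def X : Derivation ℝ A A := J.D + J.r ^ 3 • J.dp + J.r • J.dz

theorem D_apply (f : A) : J.D f = J.dx f + J.p * J.dy f + J.y * J.dz f := rfl

theorem X_apply (f : A) : J.X f = J.D f + J.r ^ 3 * J.dp f + J.r * J.dz f := rfl

theorem dz_D (f : A) : J.dz (J.D f) = J.D (J.dz f) := by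
  simp [D_apply, J.dz_dx, J.dz_dy]

theorem dr_D (f : A) : J.dr (J.D f) = J.D (J.dr f) := by
  simp [D_apply, J.dr_dx, J.dr_dy, J.dr_dz]

theorem dp_D (f : A) : J.dp (J.D f) = J.D (J.dp f) + J.dy f := by
  simp [D_apply, J.dp_dx, J.dp_dy, J.dz_dp]; ring

theorem dy_D (f : A) : J.dy (J.D f) = J.D (J.dy f) + J.dz f := by
  simp [D_apply, J.dy_dx, J.dz_dy]; ring

theorem D_r : J.D J.r = 0 := by simp [D_apply]
theorem X_p : J.X J.p = J.r ^ 3 := by simp [X_apply, D_apply]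
theorem X_y : J.X J.y = J.p := by simp [X_apply, D_apply]
theorem X_r : J.X J.r = 0 := by simp [X_apply, D_apply]

theorem dr_s : J.dr J.s = -J.s ^ 2 := by
  have h := congrArg J.dr J.r_mul_s
  simp at h
  linear_combination J.s * h - J.dr J.s * J.r_mul_s

theorem s_const {δ : Derivation ℝ A A} (hδ : δ J.r = 0) : δ J.s = 0 := by
  have h := congrArg δ J.r_mul_s
  simp [hδ] at h
  linear_combination J.s * h - δ J.s * J.r_mul_s

theorem D_s : J.D J.s = 0 := J.s_const J.D_r

theorem map_ofNat_eq_zero (δ : Derivation ℝ A A) (n : ℕ) [n.AtLeastTwo] :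
    δ (ofNat(n) : A) = 0 := δ.map_natCast n

theorem eq_zero_of_ofNat_mul {f : A} (n : ℕ) [n.AtLeastTwo] (hf : (ofNat(n) : A) * f = 0) :
    f = 0 := by
  have hn : ((n : ℕ) : ℝ) ≠ 0 := Nat.cast_ne_zero.2 (NeZero.ne n)
  refine (smul_eq_zero_iff_right hn).1 ?_
  rw [Nat.cast_smul_eq_nsmul, nsmul_eq_mul]
  exact hf

/-- The determining equations, split by powers of `r`. -/
theorem split_determining {u h : A} (hu : J.dr u = 0) (hh : J.dr h = 0)
    (H : J.r ^ 2 * J.X (3 * (J.r * J.dp u + h) - J.s * J.dz u) =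
      3 * J.r ^ 2 * u + J.X (J.X u)) :
    J.dp (J.dp u) = 0 ∧ J.dp h = 0 ∧ 3 * J.dz h = J.dy u - J.D (J.dp u) ∧
      3 * J.D h = 3 * u + 2 * J.dz (J.dz u) ∧ J.D (J.dz u) = 0 ∧ J.D (J.D u) = 0 := by
  -- The left side minus the right side of `H`, as a polynomial in r once r s = 1 has removed s. The
  -- r⁴ terms 3u_pz - u_pz - 2u_pz cancel, so degree 4 falls under the default 0.
  have key := coeff_eq_zero_of_sum_eq_zero J.dr J.dr_r 6
    (fun i => match i with
      | 0 => -J.D (J.D u)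
      | 1 => -3 * J.D (J.dz u)
      | 2 => 3 * J.D h - 3 * u - 2 * J.dz (J.dz u)
      | 3 => 3 * J.dz h - J.dy u + J.D (J.dp u)
      | 5 => 3 * J.dp h
      | 6 => 2 * J.dp (J.dp u)
      | _ => 0)
    (fun i => by
      split <;>
        simp [map_ofNat_eq_zero, J.dr_D, J.dr_dz, J.dr_dp, J.dr_dy, hu, hh])
    (by
      have hsz : J.dz J.s = 0 := J.s_const J.dz_r
      have hsp : J.dp J.s = 0 := J.s_const J.dp_r
      simp only [X_apply, map_add, map_sub, Derivation.leibniz, smul_eq_mul, J.D_r, J.D_s, hsz,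
        hsp, J.dz_D, J.dp_D, J.dz_dp, Derivation.leibniz_pow, J.dp_r, J.dz_r, smul_zero,
        mul_zero, add_zero, map_ofNat_eq_zero] at H
      simp only [Finset.sum_range_succ, Finset.sum_range_zero]
      linear_combination H + (J.r * J.D (J.dz u) + J.r ^ 4 * J.dp (J.dz u) +
        J.r ^ 2 * J.dz (J.dz u)) * J.r_mul_s)
  have k0 := key 0 (by norm_num)
  have k1 := key 1 (by norm_num)
  have k2 := key 2 (by norm_num)
  have k3 := key 3 (by norm_num)
  have k5 := key 5 (by norm_num)
  have k6 := key 6 (by norm_num)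
  simp only at k0 k1 k2 k3 k5 k6
  refine ⟨eq_zero_of_ofNat_mul 2 k6, eq_zero_of_ofNat_mul 3 k5, by linear_combination k3, by linear_combination k2,
    eq_zero_of_ofNat_mul 3 (by linear_combination -k1), by linear_combination -k0⟩

/-- The solution `u, h` of the split determining equations depends only on `h`, which satisfies
`D³ h = 0` and does not depend on `z`. -/
theorem solve_split {u h : A} (h1 : J.dp (J.dp u) = 0) (h2 : J.dp h = 0)
    (h3 : 3 * J.dz h = J.dy u - J.D (J.dp u)) (h4 : 3 * J.D h = 3 * u + 2 * J.dz (J.dz u))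
    (h5 : J.D (J.dz u) = 0) (h6 : J.D (J.D u) = 0) :
    J.dz h = 0 ∧ u = J.D h ∧ J.D (J.D (J.D h)) = 0 := by
  -- Integrability conditions of D u_z = 0, from [∂_p, D] = ∂_y and [∂_y, D] = ∂_z. The aim is u_yzz
  -- = u_zzz = 0 and D u_pzz = 0.
  have a1 : J.D (J.dp (J.dz u)) + J.dy (J.dz u) = 0 := by
    have := congrArg J.dp h5
    rwa [J.dp_D, map_zero] at this
  have hpp : J.dp (J.dp (J.dz u)) = 0 := by
    rw [← J.dz_dp, ← J.dz_dp, h1, map_zero]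
  have a2 : J.dy (J.dp (J.dz u)) = 0 := by
    have := congrArg J.dp a1
    rw [map_add, J.dp_D, hpp, J.dp_dy, map_zero, map_zero] at this
    exact eq_zero_of_ofNat_mul 2 (by linear_combination this)
  have a3 : J.D (J.dy (J.dz u)) + J.dz (J.dz u) = 0 := by
    have := congrArg J.dy h5
    rwa [J.dy_D, map_zero] at this
  have a4 : J.D (J.dp (J.dz (J.dz u))) + J.dy (J.dz (J.dz u)) = 0 := by
    have := congrArg J.dz a1
    rwa [map_add, J.dz_D, J.dz_dp, J.dz_dy, map_zero] at this
  -- Since u_ypz = 0, the ∂_y-derivative of this identity is 2 D u_pzz = u_yzz. Together with D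
  -- u_pzz + u_yzz = 0 it makes both terms vanish.
  have a5 : J.D (J.D (J.dp (J.dz u))) = J.dz (J.dz u) := by
    have := congrArg J.D a1
    rw [map_add, map_zero] at this
    linear_combination this - a3
  have a6 : 2 * J.D (J.dp (J.dz (J.dz u))) = J.dy (J.dz (J.dz u)) := by
    have := congrArg J.dy a5
    rw [J.dy_D, J.dy_D, J.dz_D, J.dz_dp, map_add, a2, map_zero, map_zero] at this
    linear_combination this
  have a7 : J.D (J.dp (J.dz (J.dz u))) = 0 :=
    eq_zero_of_ofNat_mul 3 (by linear_combination a4 + a6)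
  have a8 : J.dy (J.dz (J.dz u)) = 0 := by linear_combination a4 - a7
  have a9 : J.dp (J.dz (J.dz (J.dz u))) = 0 := by
    have := congrArg J.dy a7
    rw [J.dy_D, ← J.dp_dy, a8, map_zero, map_zero, map_zero, J.dz_dp] at this
    linear_combination this
  have a10 : J.dz (J.dz (J.dz u)) = 0 := by
    have := congrArg J.dz a3
    rw [map_add, J.dz_D, J.dz_dy, a8, map_zero, map_zero] at this
    linear_combination this
  -- Differentiating `h4` by ∂_p and ∂_y gives D h_y = D u_p and u_y = D h_y + h_z, so `h3` turns
  -- into 3h_z = h_z.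
  have b1 : 3 * J.dy h = 3 * J.dp u + 2 * J.dp (J.dz (J.dz u)) := by
    have := congrArg J.dp h4
    simpa [map_ofNat_eq_zero, J.dp_D, h2] using this
  have b2 : 3 * J.D (J.dy h) = 3 * J.D (J.dp u) := by
    have := congrArg J.D b1
    simpa [map_ofNat_eq_zero, a7] using this
  have b3 : 3 * (J.D (J.dy h) + J.dz h) = 3 * J.dy u := by
    have := congrArg J.dy h4
    simpa only [map_add, Derivation.leibniz, map_ofNat_eq_zero, J.dy_D, a8, smul_eq_mul,
      mul_zero, add_zero] using this
  have b4 : J.dz h = 0 :=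
    eq_zero_of_ofNat_mul 2 (eq_zero_of_ofNat_mul 3 (by linear_combination 3 * h3 - b3 + b2))
  have b5 : J.dz u = 0 := by
    have := congrArg J.dz h4
    simp only [map_add, Derivation.leibniz, map_ofNat_eq_zero, J.dz_D, b4, a10, smul_eq_mul,
      mul_zero, add_zero, map_zero] at this
    exact eq_zero_of_ofNat_mul 3 this.symm
  have b6 : J.D h = u := by
    rw [b5, map_zero] at h4
    exact sub_eq_zero.1 (eq_zero_of_ofNat_mul 3 (by linear_combination h4))
  exact ⟨b4, b6.symm, by rw [b6, h6]⟩

/-- A function of `x, y` alone with `D³ h = 0` has vanishing third derivatives. -/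
theorem third_derivatives {h : A} (hp : J.dp h = 0) (hz : J.dz h = 0)
    (hD : J.D (J.D (J.D h)) = 0) :
    J.dx (J.dx (J.dx h)) = 0 ∧ J.dx (J.dx (J.dy h)) = 0 ∧ J.dx (J.dy (J.dy h)) = 0 ∧
      J.dy (J.dy (J.dy h)) = 0 := by
  -- As h depends on neither p nor z, D acts on h and its x, y-derivatives as ∂_x + p∂_y, and D³h is
  -- a binomial cubic in p with p-free coefficients.
  have key := coeff_eq_zero_of_sum_eq_zero J.dp J.dp_p 3
    (fun i => match i with
      | 0 => J.dx (J.dx (J.dx h))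
      | 1 => 3 * J.dx (J.dx (J.dy h))
      | 2 => 3 * J.dx (J.dy (J.dy h))
      | 3 => J.dy (J.dy (J.dy h))
      | _ => 0)
    (fun i => by
      split <;> simp [map_ofNat_eq_zero, J.dp_dx, J.dp_dy, hp])
    (by
      simp only [D_apply, map_add, Derivation.leibniz, smul_eq_mul, J.dz_dx, J.dz_dy, J.dy_dx,
        J.dz_p, J.dx_p, J.dy_p, hz, map_zero, mul_zero, add_zero] at hD
      simp only [Finset.sum_range_succ, Finset.sum_range_zero]
      linear_combination hD)
  have k0 := key 0 (by norm_num)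
  have k1 := key 1 (by norm_num)
  have k2 := key 2 (by norm_num)
  have k3 := key 3 (by norm_num)
  exact ⟨k0, eq_zero_of_ofNat_mul 3 k1, eq_zero_of_ofNat_mul 3 k2, k3⟩

/-- Infinitesimal symmetries have a generating function `h`. -/
theorem exists_generating_function {a b c e f : A} (hb : J.dr b = J.p * J.dr a)
    (hc : J.dr c = J.r ^ 3 * J.dr a) (hf : J.dr f = (J.y + J.r) * J.dr a)
    (hXb : c - J.X b = -(J.p * J.X a)) (hXc : e - J.X c = -(J.r ^ 3 * J.X a))
    (hXf : 3 * J.r ^ 2 * (b - J.X f + (J.y + J.r) * J.X a) + e = 0) :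
    ∃ h : A, J.dp h = 0 ∧ J.dr h = 0 ∧ J.dz h = 0 ∧
      J.dx (J.dx (J.dx h)) = 0 ∧ J.dx (J.dx (J.dy h)) = 0 ∧ J.dx (J.dy (J.dy h)) = 0 ∧
      J.dy (J.dy (J.dy h)) = 0 ∧ a = -J.dy h ∧ b = J.dx h ∧
      c = J.dx (J.dx h) + 2 * J.p * J.dx (J.dy h) + J.p ^ 2 * J.dy (J.dy h) ∧
      e = 3 * J.r ^ 3 * (J.dx (J.dy h) + J.p * J.dy (J.dy h)) ∧
      f = h - J.y * J.dy h := by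
  -- u, w, g are the values on the field of the forms dy - p dx, dp - r³dx and dz - (y + r)dx, which
  -- cut out the distribution.
  obtain ⟨u, hu⟩ : ∃ u, u = b - J.p * a := ⟨_, rfl⟩
  obtain ⟨w, hw⟩ : ∃ w, w = c - J.r ^ 3 * a := ⟨_, rfl⟩
  obtain ⟨g, hg⟩ : ∃ g, g = f - (J.y + J.r) * a := ⟨_, rfl⟩
  have ur : J.dr u = 0 := by simp [hu, hb]
  have wr : J.dr w = -3 * J.r ^ 2 * a := by simp [hw, hc]; ring
  have gr : J.dr g = -a := by simp [hg, hf]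
  have Xu : J.X u = w := by
    simp only [hu, hw, map_sub, Derivation.leibniz, X_p, smul_eq_mul]
    linear_combination -hXb
  have Xw : J.X w = e := by
    simp only [hw, map_sub, Derivation.leibniz, Derivation.leibniz_pow, X_r,
      smul_eq_mul]
    linear_combination -hXc
  have Xg : 3 * J.r ^ 2 * J.X g = 3 * J.r ^ 2 * u + e := by
    simp only [hg, hu, map_sub, map_add, Derivation.leibniz, X_r, X_y, smul_eq_mul]
    linear_combination -hXf
  have wr' : J.dr w = 3 * J.r ^ 2 * J.dp u + J.dz u := by
    rw [← Xu]
    simp [X_apply, J.dr_D, J.dr_dp, J.dr_dz, ur]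
    ring
  -- The two expressions for w_r give g_r = -a = u_p + s²u_z/3, with s = 1/r. Since r u_p - s u_z/3
  -- has this r-derivative, h is the constant of integration.
  obtain ⟨h, hh⟩ : ∃ h, 3 * h = 3 * g - 3 * (J.r * J.dp u) + J.s * J.dz u :=
    ⟨g - J.r * J.dp u + (1 / 3 : ℝ) • (J.s * J.dz u), by
      have : 3 * ((1 / 3 : ℝ) • (J.s * J.dz u)) = J.s * J.dz u := by
        rw [show ∀ t : A, 3 * t = (3 : ℝ) • t from fun t => by
          rw [ofNat_smul_eq_nsmul, nsmul_eq_mul]; norm_num, smul_smul]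
        norm_num
      linear_combination this⟩
  have hr : J.dr h = 0 := by
    have := congrArg J.dr hh
    simp [map_ofNat_eq_zero, J.dr_dp, J.dr_dz, ur, J.dr_s, gr] at this
    refine eq_zero_of_ofNat_mul 3 ?_
    linear_combination this + J.s ^ 2 * (wr' - wr) +
      3 * (J.dp u + a) * (J.r * J.s + 1) * J.r_mul_s
  obtain ⟨c1, c2, c3, c4, c5, c6⟩ := J.split_determining ur hr (by
    rw [Xu, Xw, ← Xg, show 3 * (J.r * J.dp u + h) - J.s * J.dz u = 3 * g by
      linear_combination hh]
    simp [map_ofNat_eq_zero]; ring)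
  obtain ⟨hz, rfl, hD⟩ := J.solve_split c1 c2 c3 c4 c5 c6
  obtain ⟨d1, d2, d3, d4⟩ := J.third_derivatives c2 hz hD
  have hy : J.dp (J.D h) = J.dy h := by rw [J.dp_D, c2, map_zero, zero_add]
  have ha : a = -J.dy h := by
    rw [J.dz_D, hz, map_zero, hy] at wr'
    refine sub_eq_zero.1 (eq_zero_of_ofNat_mul 3 ?_)
    linear_combination J.s ^ 2 * (wr - wr') - 3 * (a + J.dy h) * (J.r * J.s + 1) * J.r_mul_s
  have hb' : b = J.dx h := by
    rw [ha, D_apply, hz] at hu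
    linear_combination -hu
  have hw' : w = J.D (J.D h) + J.r ^ 3 * J.dy h := by
    rw [← Xu, X_apply, hy, J.dz_D, hz, map_zero]; ring
  have hDD : J.D (J.D h) = J.dx (J.dx h) + 2 * J.p * J.dx (J.dy h) + J.p ^ 2 * J.dy (J.dy h) := by
    simp [D_apply, hz, J.dy_dx, J.dz_dx, J.dz_dy]; ring
  refine ⟨h, c2, hr, hz, d1, d2, d3, d4, ha, hb', ?_, ?_, ?_⟩
  · rw [← hDD]
    linear_combination hw' - hw + J.r ^ 3 * ha
  · rw [← Xw, hw', hDD]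
    have e1 : J.dy (J.dx (J.dx h)) = 0 := by rw [J.dy_dx, J.dy_dx, d2]
    have e2 : J.dy (J.dx (J.dy h)) = 0 := by rw [J.dy_dx, d3]
    simp [X_apply, D_apply, J.dz_dx, J.dz_dy, J.dp_dx, J.dp_dy, map_ofNat_eq_zero, c2, hz,
      d1, d2, d3, d4, e1, e2]
    ring
  · rw [hy, J.dz_D, hz, map_zero] at hh
    refine sub_eq_zero.1 (eq_zero_of_ofNat_mul 3 ?_)
    linear_combination -hh - 3 * hg + 3 * (J.y + J.r) * ha

/-- The determining equations of infinitesimal symmetries. -/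
def Determining (s : Fin 5 → A) : Prop :=
  J.dr (s 1) = J.p * J.dr (s 0) ∧ J.dr (s 2) = J.r ^ 3 * J.dr (s 0) ∧
  J.dr (s 4) = (J.y + J.r) * J.dr (s 0) ∧
  s 2 - J.X (s 1) = -(J.p * J.X (s 0)) ∧ s 3 - J.X (s 2) = -(J.r ^ 3 * J.X (s 0)) ∧
  3 * J.r ^ 2 * (s 1 - J.X (s 4) + (J.y + J.r) * J.X (s 0)) + s 3 = 0

end JetDerivations

/-! ### Coefficient vectors and structure constants -/

/-- The components of the linear combination of `S₁, …, S₆` with coefficients `k`, as functions of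
the coordinates `x, y, y₁, y₂`. -/
def combComp (x y p q : A) (k : Fin 6 → ℝ) : Fin 5 → A :=
  ![k 1 • x + k 2 • y + algebraMap ℝ A (k 3), k 0 • x - k 1 • y + algebraMap ℝ A (k 4),
    algebraMap ℝ A (k 0) - (2 * k 1) • p - k 2 • p ^ 2, -(3 * k 1) • q - (3 * k 2) • (p * q),
    (k 0 / 2) • x ^ 2 + (k 2 / 2) • y ^ 2 + k 4 • x + algebraMap ℝ A (k 5)]

theorem map_combComp {B : Type*} [CommRing B] [Algebra ℝ B] (φ : A →ₐ[ℝ] B) (x y p q : A)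
    (k : Fin 6 → ℝ) (i : Fin 5) :
    φ (combComp x y p q k i) = combComp (φ x) (φ y) (φ p) (φ q) k i := by
  fin_cases i <;> simp [combComp]

/-- The structure constants of the Lie algebra spanned by `S₁, …, S₆`. -/
def combBracket (k l : Fin 6 → ℝ) : Fin 6 → ℝ :=
  ![2 * (k 1 * l 0 - k 0 * l 1), k 0 * l 2 - k 2 * l 0, 2 * (k 2 * l 1 - k 1 * l 2),
    k 3 * l 1 - k 1 * l 3 + (k 4 * l 2 - k 2 * l 4),
    k 3 * l 0 - k 0 * l 3 + (k 1 * l 4 - k 4 * l 1), k 3 * l 4 - k 4 * l 3]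

theorem bracket_combComp (d : Fin 5 → Derivation ℝ A A) (c : Fin 5 → A)
    (hd : ∀ i j, d i (c j) = if i = j then 1 else 0) (k l : Fin 6 → ℝ) (i : Fin 5) :
    ∑ j, combComp (c 0) (c 1) (c 2) (c 3) k j * d j (combComp (c 0) (c 1) (c 2) (c 3) l i) -
      ∑ j, combComp (c 0) (c 1) (c 2) (c 3) l j * d j (combComp (c 0) (c 1) (c 2) (c 3) k i) =
    combComp (c 0) (c 1) (c 2) (c 3) (combBracket k l) i := by
  -- Halving the coefficients that occur as k/2 leaves identities that `ring` can check in a mere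
  -- commutative ring.
  obtain ⟨a, ha⟩ : ∃ a, k 0 = 2 * a := ⟨k 0 / 2, by ring⟩
  obtain ⟨b, hb⟩ : ∃ a, l 0 = 2 * a := ⟨l 0 / 2, by ring⟩
  obtain ⟨a', ha'⟩ : ∃ a, k 2 = 2 * a := ⟨k 2 / 2, by ring⟩
  obtain ⟨b', hb'⟩ : ∃ a, l 2 = 2 * a := ⟨l 2 / 2, by ring⟩
  have h2 : algebraMap ℝ A 2 = 2 := map_ofNat _ 2
  have h3 : algebraMap ℝ A 3 = 3 := map_ofNat _ 3
  rw [Fin.sum_univ_five, Fin.sum_univ_five]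
  fin_cases i <;>
    simp [combComp, combBracket, hd, Algebra.smul_def, ha, hb, ha', hb', h2, h3,
      JetDerivations.map_ofNat_eq_zero] <;> ring

namespace JetDerivations

variable (J : JetDerivations A)

/-- The ∂_x and ∂_y components are affine in x, y and already involve every coefficient except that
of S₆. This serves both linear independence and the kernel of the projection. -/
theorem coeff_eq_zero_of_combComp (hinj : ∀ a : ℝ, algebraMap ℝ A a = 0 → a = 0)
    {k : Fin 6 → ℝ} {q : A} (h0 : combComp J.x J.y J.p q k 0 = 0)
    (h1 : combComp J.x J.y J.p q k 1 = 0) : ∀ i ≠ 5, k i = 0 := by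
  replace h0 : k 1 • J.x + k 2 • J.y + algebraMap ℝ A (k 3) = 0 := h0
  replace h1 : k 0 • J.x - k 1 • J.y + algebraMap ℝ A (k 4) = 0 := h1
  have k1 : k 1 = 0 := hinj _ (by
    simpa [Algebra.algebraMap_eq_smul_one] using congrArg J.dx h0)
  have k2 : k 2 = 0 := hinj _ (by
    simpa [Algebra.algebraMap_eq_smul_one] using congrArg J.dy h0)
  have k0 : k 0 = 0 := hinj _ (by
    simpa [Algebra.algebraMap_eq_smul_one] using congrArg J.dx h1)
  have k3 : k 3 = 0 := hinj _ (by simpa only [k1, k2, zero_smul, zero_add] using h0)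
  have k4 : k 4 = 0 := hinj _ (by simpa only [k0, k1, zero_smul, zero_add, sub_zero] using h1)
  intro i hi
  fin_cases i
  · exact k0
  · exact k1
  · exact k2
  · exact k3
  · exact k4
  · exact absurd rfl hi

theorem eq_zero_of_combComp (hinj : ∀ a : ℝ, algebraMap ℝ A a = 0 → a = 0) {k : Fin 6 → ℝ}
    {q : A} (h : combComp J.x J.y J.p q k = 0) : k = 0 := by
  have hk := J.coeff_eq_zero_of_combComp hinj (congrFun h 0) (congrFun h 1)
  have h4 : (k 0 / 2) • J.x ^ 2 + (k 2 / 2) • J.y ^ 2 + k 4 • J.x + algebraMap ℝ A (k 5) = 0 :=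
    congrFun h 4
  have k5 : k 5 = 0 := hinj _ (by
    simpa only [hk 0 (by decide), hk 2 (by decide), hk 4 (by decide), zero_div, zero_smul,
      zero_add] using h4)
  ext i
  by_cases hi : i = 5
  · rw [hi, k5]; rfl
  · exact hk i hi

theorem determining_combComp (k : Fin 6 → ℝ) :
    J.Determining (combComp J.x J.y J.p (J.r ^ 3) k) := by
  obtain ⟨a, ha⟩ : ∃ a, k 0 = 2 * a := ⟨k 0 / 2, by ring⟩
  obtain ⟨b, hb⟩ : ∃ a, k 2 = 2 * a := ⟨k 2 / 2, by ring⟩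
  have h2 : algebraMap ℝ A 2 = 2 := map_ofNat _ 2
  have h3 : algebraMap ℝ A 3 = 3 := map_ofNat _ 3
  refine ⟨?_, ?_, ?_, ?_, ?_, ?_⟩ <;>
    simp [combComp, Algebra.smul_def, ha, hb, h2, h3, X_apply, D_apply, map_ofNat_eq_zero] <;> ring

/-- If the constants of the derivations are the real numbers, then the solutions of the
determining equations are the linear combinations of `S₁, …, S₆`. -/
theorem Determining.exists_combComp {J : JetDerivations A} {s : Fin 5 → A} (hs : J.Determining s)
    (hconst : ∀ f : A, J.dx f = 0 → J.dy f = 0 → J.dp f = 0 → J.dr f = 0 → J.dz f = 0 →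
      ∃ k : ℝ, f = algebraMap ℝ A k) :
    ∃ k : Fin 6 → ℝ, s = combComp J.x J.y J.p (J.r ^ 3) k := by
  obtain ⟨hb, hc, hf, hXb, hXc, hXf⟩ := hs
  obtain ⟨h, hp, hr, hz, d1, d2, d3, d4, ha, hb, hc, he, hf⟩ :=
    J.exists_generating_function hb hc hf hXb hXc hXf
  have e1 : J.dy (J.dx (J.dx h)) = 0 := by rw [J.dy_dx, J.dy_dx, d2]
  have e2 : J.dy (J.dx (J.dy h)) = 0 := by rw [J.dy_dx, d3]
  -- The second derivatives of h are constants. Integrating twice gives h = (k0/2)x² - k1 xy -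
  -- (k2/2)y² + k4 x - k3 y + k5, the signs being fixed by a = -h_y and b = h_x.
  obtain ⟨k0, h0⟩ := hconst (J.dx (J.dx h)) d1 e1 (by simp [J.dp_dx, hp])
    (by simp [J.dr_dx, hr]) (by simp [J.dz_dx, hz])
  obtain ⟨k1, h1⟩ := hconst (-J.dx (J.dy h)) (by simp [d2]) (by simp [e2])
    (by simp [J.dp_dx, J.dp_dy, hp]) (by simp [J.dr_dx, J.dr_dy, hr])
    (by simp [J.dz_dx, J.dz_dy, hz])
  obtain ⟨k2, h2⟩ := hconst (-J.dy (J.dy h)) (by simp [d3]) (by simp [d4])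
    (by simp [J.dp_dy, hp]) (by simp [J.dr_dy, hr]) (by simp [J.dz_dy, hz])
  obtain ⟨k4, h4⟩ := hconst (J.dx h - k0 • J.x + k1 • J.y)
    (by simp [h0, Algebra.algebraMap_eq_smul_one])
    (by simp [J.dy_dx, ← Algebra.algebraMap_eq_smul_one, ← h1])
    (by simp [J.dp_dx, hp]) (by simp [J.dr_dx, hr]) (by simp [J.dz_dx, hz])
  obtain ⟨k3, h3⟩ := hconst (-J.dy h - k1 • J.x - k2 • J.y)
    (by simp [h1, ← Algebra.algebraMap_eq_smul_one])
    (by simp [h2, ← Algebra.algebraMap_eq_smul_one])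
    (by simp [J.dp_dy, hp]) (by simp [J.dr_dy, hr]) (by simp [J.dz_dy, hz])
  have hx : J.dx h = k0 • J.x - k1 • J.y + algebraMap ℝ A k4 := by linear_combination h4
  have hy : J.dy h = -(k1 • J.x) - k2 • J.y - algebraMap ℝ A k3 := by linear_combination -h3
  obtain ⟨m0, rfl⟩ : ∃ m, k0 = 2 * m := ⟨k0 / 2, by ring⟩
  obtain ⟨m2, rfl⟩ : ∃ m, k2 = 2 * m := ⟨k2 / 2, by ring⟩
  obtain ⟨k5, h5⟩ := hconst
    (h - m0 • J.x ^ 2 + k1 • (J.x * J.y) + m2 • J.y ^ 2 - k4 • J.x + k3 • J.y)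
    (by
      simp only [map_sub, map_add, Derivation.leibniz_pow,
        Derivation.leibniz, dx_x, dx_y, hx, Algebra.smul_def, map_mul, map_ofNat]
      simp
      ring)
    (by
      simp only [map_sub, map_add, Derivation.leibniz_pow,
        Derivation.leibniz, dy_x, dy_y, hy, Algebra.smul_def, map_mul, map_ofNat]
      simp
      ring)
    (by simp [hp]) (by simp [hr]) (by simp [hz])
  refine ⟨![2 * m0, k1, 2 * m2, k3, k4, k5], funext fun i => ?_⟩
  fin_cases i <;> simp [combComp, Algebra.smul_def, map_mul, map_ofNat] at *
  · linear_combination ha - hy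
  · linear_combination hb + hx
  · linear_combination hc + h0 - 2 * J.p * h1 - J.p ^ 2 * h2
  · linear_combination he - 3 * J.r ^ 3 * (h1 + J.p * h2)
  · linear_combination hf - J.y * hy + h5

end JetDerivations
end DifferentialAlgebra

/-! ### The algebra of smooth functions on an open set -/

section SmoothFunctions

variable {E : Type*} [NormedAddCommGroup E] [NormedSpace ℝ E]

/-- The algebra of smooth real functions on the open set `U`. -/
def smoothFunctions (U : Opens E) : Subalgebra ℝ (U → ℝ) where
  carrier := {f | ∃ g : E → ℝ, ContDiffOn ℝ ∞ g U ∧ ∀ p : U, f p = g p}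
  mul_mem' := by
    rintro _ _ ⟨g, hg, h⟩ ⟨g', hg', h'⟩
    exact ⟨g * g', hg.mul hg', fun p => by simp [h, h']⟩
  add_mem' := by
    rintro _ _ ⟨g, hg, h⟩ ⟨g', hg', h'⟩
    exact ⟨g + g', hg.add hg', fun p => by simp [h, h']⟩
  algebraMap_mem' c := ⟨fun _ => c, contDiffOn_const, fun _ => rfl⟩

namespace smoothFunctions

variable {U : Opens E}

/-- The restriction to `U` of a function that is smooth on `U`. -/
def mk (g : E → ℝ) (hg : ContDiffOn ℝ ∞ g U) : smoothFunctions U :=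
  ⟨fun p => g p, g, hg, fun _ => rfl⟩

theorem mk_apply (g : E → ℝ) (hg : ContDiffOn ℝ ∞ g U) (p : U) : (mk g hg).1 p = g p := rfl

theorem exists_mk (f : smoothFunctions U) : ∃ g hg, f = mk g hg := by
  obtain ⟨f, g, hg, h⟩ := f
  exact ⟨g, hg, Subtype.ext (funext h)⟩

theorem ext {f g : smoothFunctions U} (h : ∀ p : U, f.1 p = g.1 p) : f = g :=
  Subtype.ext (funext h)

theorem contDiffOn_fderiv_apply {g : E → ℝ} (hg : ContDiffOn ℝ ∞ g U) (v : E) :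
    ContDiffOn ℝ ∞ (fun p => fderiv ℝ g p v) U :=
  (hg.fderiv_of_isOpen U.isOpen le_rfl).clm_apply contDiffOn_const

theorem fderiv_congr {g g' : E → ℝ} (h : ∀ p : U, g p = g' p) (p : U) :
    fderiv ℝ g p = fderiv ℝ g' p :=
  Filter.EventuallyEq.fderiv_eq (Filter.eventuallyEq_of_mem (U.isOpen.mem_nhds p.2)
    fun q hq => h ⟨q, hq⟩)

theorem differentiableAt {g : E → ℝ} (hg : ContDiffOn ℝ ∞ g U) (p : U) :
    DifferentiableAt ℝ g p :=
  (hg.contDiffAt (U.isOpen.mem_nhds p.2)).differentiableAt (by simp)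

/-- Evaluation at a point. -/
def ev (p : U) : smoothFunctions U →ₐ[ℝ] ℝ :=
  (Pi.evalAlgHom ℝ (fun _ : U => ℝ) p).comp (smoothFunctions U).val

theorem ev_apply (p : U) (f : smoothFunctions U) : ev p f = f.1 p := rfl

/-- The directional derivative of a smooth function as a smooth function. -/
def pdFun (v : E) (f : smoothFunctions U) : smoothFunctions U :=
  mk (fun p => fderiv ℝ f.2.choose p v) (contDiffOn_fderiv_apply f.2.choose_spec.1 v)

/-- Two extensions that agree on the open set U have the same derivative there, so the choice made
in `pdFun` is immaterial. -/
theorem pdFun_mk (v : E) {g : E → ℝ} (hg : ContDiffOn ℝ ∞ g U) :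
    pdFun v (mk g hg) = mk (fun p => fderiv ℝ g p v) (contDiffOn_fderiv_apply hg v) :=
  ext fun p => congrArg (fun L : E →L[ℝ] ℝ => L v)
    (fderiv_congr (fun q => ((mk g hg).2.choose_spec.2 q).symm) p)

/-- The directional derivative, as a derivation of the algebra of smooth functions. -/
def pd (v : E) : Derivation ℝ (smoothFunctions U) (smoothFunctions U) :=
  Derivation.mk'
    { toFun := pdFun v
      map_add' := fun f f' => by
        obtain ⟨g, hg, rfl⟩ := exists_mk f
        obtain ⟨g', hg', rfl⟩ := exists_mk f'
        refine (pdFun_mk v (hg.add hg')).trans (ext fun p => ?_)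
        rw [pdFun_mk, pdFun_mk]
        exact congrArg (fun L : E →L[ℝ] ℝ => L v)
          (fderiv_add (differentiableAt hg p) (differentiableAt hg' p))
      map_smul' := fun c f => by
        obtain ⟨g, hg, rfl⟩ := exists_mk f
        refine (pdFun_mk v (hg.const_smul c)).trans (ext fun p => ?_)
        rw [pdFun_mk]
        exact congrArg (fun L : E →L[ℝ] ℝ => L v) (fderiv_const_smul (differentiableAt hg p) c) }
    fun f f' => by
      obtain ⟨g, hg, rfl⟩ := exists_mk f
      obtain ⟨g', hg', rfl⟩ := exists_mk f'
      refine (pdFun_mk v (hg.mul hg')).trans (ext fun p => ?_)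
      rw [LinearMap.coe_mk, AddHom.coe_mk, pdFun_mk, pdFun_mk]
      exact congrArg (fun L : E →L[ℝ] ℝ => L v)
          (fderiv_mul (differentiableAt hg p) (differentiableAt hg' p))

theorem pd_mk (v : E) {g : E → ℝ} (hg : ContDiffOn ℝ ∞ g U) :
    pd v (mk g hg) = mk (fun p => fderiv ℝ g p v) (contDiffOn_fderiv_apply hg v) :=
  pdFun_mk v hg

theorem pd_comm (v w : E) (f : smoothFunctions U) : pd v (pd w f) = pd w (pd v f) := by
  obtain ⟨g, hg, rfl⟩ := exists_mk f
  rw [pd_mk, pd_mk, pd_mk, pd_mk]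
  refine ext fun p => ?_
  have hg' : ContDiffAt ℝ ∞ g p := hg.contDiffAt (U.isOpen.mem_nhds p.2)
  have hd : DifferentiableAt ℝ (fderiv ℝ g) p :=
    (hg'.fderiv_right (m := ∞) le_rfl).differentiableAt (by simp)
  have hs : IsSymmSndFDerivAt ℝ g p := hg'.isSymmSndFDerivAt (by
    rw [minSmoothness_of_isRCLikeNormedField]
    exact WithTop.coe_le_coe.2 (le_top : (2 : ℕ∞) ≤ ⊤))
  simp only [mk_apply]
  rw [fderiv_clm_apply hd (differentiableAt_const w), fderiv_clm_apply hd
    (differentiableAt_const v)]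
  simpa using hs v w

theorem pd_linearMap (v : E) (L : E →L[ℝ] ℝ) :
    pd v (mk L L.contDiff.contDiffOn : smoothFunctions U) =
      algebraMap ℝ (smoothFunctions U) (L v) := by
  rw [pd_mk]
  exact ext fun p => by simp [mk_apply]

end smoothFunctions

end SmoothFunctions

/-! ### Partial derivatives and components of vector fields -/

section Coordinates

variable {n : ℕ} {U : Opens (Fin n → ℝ)}

namespace smoothFunctions

/-- The coordinate functions. -/
def coord (i : Fin n) : smoothFunctions U :=
  mk (ContinuousLinearMap.proj (R := ℝ) (φ := fun _ : Fin n => ℝ) i)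
    (ContinuousLinearMap.contDiff _).contDiffOn

/-- The partial derivatives. -/
abbrev pdi (i : Fin n) : Derivation ℝ (smoothFunctions U) (smoothFunctions U) :=
  pd (Pi.single i 1)

theorem pdi_coord (i j : Fin n) :
    pdi i (coord j : smoothFunctions U) = if i = j then 1 else 0 := by
  refine (pd_linearMap _ _).trans ?_
  by_cases h : i = j
  · simp [h]
  · simp [h, Ne.symm h]

theorem pdi_apply (i : Fin n) {g : (Fin n → ℝ) → ℝ} (hg : ContDiffOn ℝ ∞ g U) (p : U) :
    (pdi i (mk g hg)).1 p = fderiv ℝ g p (Pi.single i 1) := by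
  rw [pd_mk, mk_apply]

theorem fderiv_apply_eq_sum (L : (Fin n → ℝ) →L[ℝ] ℝ) (v : Fin n → ℝ) :
    L v = ∑ i, v i * L (Pi.single i 1) := by
  conv_lhs => rw [← Finset.univ_sum_single v, map_sum]
  refine Finset.sum_congr rfl fun i _ => ?_
  rw [← smul_eq_mul, ← map_smul, ← Pi.single_smul', smul_eq_mul, mul_one]

/-- Connectedness of U enters the classification of symmetries here: the constants of integration
are global real numbers. -/
theorem exists_const (hU : IsPreconnected (U : Set (Fin n → ℝ))) (f : smoothFunctions U)
    (hf : ∀ i, pdi i f = 0) : ∃ k : ℝ, f = algebraMap ℝ (smoothFunctions U) k := by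
  obtain ⟨g, hg, rfl⟩ := exists_mk f
  obtain ⟨k, hk⟩ := U.isOpen.exists_is_const_of_fderiv_eq_zero hU
    (fun p hp => (differentiableAt hg ⟨p, hp⟩).differentiableWithinAt) (fun p hp => by
      refine ContinuousLinearMap.ext fun v => ?_
      rw [fderiv_apply_eq_sum, Finset.sum_eq_zero]
      · rfl
      · intro i _
        rw [← pdi_apply i hg ⟨p, hp⟩, hf i]
        exact mul_zero _)
  exact ⟨k, ext fun p => hk p p.2⟩

/-- The components of a smooth vector field. -/
def comp {X : (Fin n → ℝ) → Fin n → ℝ} (hX : ContDiffOn ℝ ∞ X U) (i : Fin n) :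
    smoothFunctions U :=
  mk (fun p => X p i) (contDiffOn_pi.1 hX i)

theorem ev_comp {X : (Fin n → ℝ) → Fin n → ℝ} (hX : ContDiffOn ℝ ∞ X U) (i : Fin n) (p : U) :
    ev p (comp hX i) = X p i := rfl

theorem ev_coord (i : Fin n) (p : U) : ev p (coord i : smoothFunctions U) = p.1 i := rfl

theorem ev_pdi_mk (i : Fin n) {g : (Fin n → ℝ) → ℝ} (hg : ContDiffOn ℝ ∞ g U) (p : U) :
    ev p (pdi i (mk g hg)) = fderiv ℝ g p (Pi.single i 1) := pdi_apply i hg p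

theorem fderiv_comp_apply {Y : (Fin n → ℝ) → Fin n → ℝ} (hY : ContDiffOn ℝ ∞ Y U) (v : Fin n → ℝ)
    (i : Fin n) (p : U) : fderiv ℝ Y p v i = ∑ j, v j * ev p (pdi j (comp hY i)) := by
  have hd : DifferentiableAt ℝ Y p :=
    (hY.contDiffAt (U.isOpen.mem_nhds p.2)).differentiableAt (by simp)
  have h : fderiv ℝ (fun q => Y q i) p v = fderiv ℝ Y p v i := by
    rw [_root_.fderiv_apply hd i]; rfl
  rw [← h, fderiv_apply_eq_sum]
  exact Finset.sum_congr rfl fun j _ => by rw [comp, ev_pdi_mk]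

/-- The bridge from analytic brackets to the differential algebra: [X, Y]ⁱ = X(Yⁱ) - Y(Xⁱ). -/
theorem comp_lieBracket {X Y : (Fin n → ℝ) → Fin n → ℝ} (hX : ContDiffOn ℝ ∞ X U)
    (hY : ContDiffOn ℝ ∞ Y U) (i : Fin n) (p : U) :
    lieBracket ℝ X Y p i = ev p (∑ j, comp hX j * pdi j (comp hY i) -
      ∑ j, comp hY j * pdi j (comp hX i)) := by
  simp only [map_sub, map_sum, map_mul, ev_comp]
  rw [← fderiv_comp_apply, ← fderiv_comp_apply]
  rfl

end smoothFunctions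

end Coordinates

/-! ### The cube root as a coordinate -/

section CubeRoot

theorem contDiffAt_cbrt {t : ℝ} (ht : t ≠ 0) : ContDiffAt ℝ ∞ cbrt t := by
  rcases lt_or_gt_of_ne ht with h | h
  · have h1 : ContDiffAt ℝ ∞ (fun s : ℝ => -(-s) ^ (1 / 3 : ℝ)) t :=
      (contDiffAt_id.neg.rpow_const_of_ne (by simpa using ht)).neg
    refine h1.congr_of_eventuallyEq ?_
    filter_upwards [Iio_mem_nhds h] with s hs
    have hs : s < 0 := hs
    simp [cbrt, sign_neg hs, abs_of_neg hs]
  · have h1 : ContDiffAt ℝ ∞ (fun s : ℝ => s ^ (1 / 3 : ℝ)) t :=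
      contDiffAt_id.rpow_const_of_ne ht
    refine h1.congr_of_eventuallyEq ?_
    filter_upwards [Ioi_mem_nhds h] with s hs
    have hs : 0 < s := hs
    simp [cbrt, sign_pos hs, abs_of_pos hs]

theorem cbrt_ne_zero {t : ℝ} (ht : t ≠ 0) : cbrt t ≠ 0 := fun h => ht (by
  rw [← cbrt_pow_three t, h]; norm_num)

namespace smoothFunctions

variable {U : Opens J20} (hreg : ∀ p ∈ U, p 3 ≠ 0)

include hreg in
theorem contDiffOn_cbrt : ContDiffOn ℝ ∞ (fun p : J20 => cbrt (p 3)) U := fun p hp =>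
  ((contDiffAt_cbrt (hreg p hp)).comp p
    (ContinuousLinearMap.proj (R := ℝ) (φ := fun _ : Fin 5 => ℝ) 3).contDiff.contDiffAt
    ).contDiffWithinAt

/-- The function `y₂^{1/3}`. -/
def root : smoothFunctions U := mk (fun p => cbrt (p 3)) (contDiffOn_cbrt hreg)

/-- The function `y₂^{-1/3}`. -/
def rootInv : smoothFunctions U := mk (fun p => (cbrt (p 3))⁻¹)
  ((contDiffOn_cbrt hreg).inv fun p hp => cbrt_ne_zero (hreg p hp))

theorem root_mul_rootInv : root hreg * rootInv hreg = 1 :=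
  ext fun p => mul_inv_cancel₀ (cbrt_ne_zero (hreg p p.2))

theorem root_pow_three : root hreg ^ 3 = coord 3 := ext fun p => cbrt_pow_three (p.1 3)

/-- Implicit differentiation of r³ = y₂. -/
theorem pdi_root (i : Fin 5) : 3 * root hreg ^ 2 * pdi i (root hreg) = if i = 3 then 1 else 0 := by
  rw [← pdi_coord, ← root_pow_three hreg, Derivation.leibniz_pow]
  simp [mul_assoc]

theorem pdi_root_of_ne {i : Fin 5} (hi : i ≠ 3) : pdi i (root hreg) = 0 := by
  have h := pdi_root hreg i
  rw [if_neg hi] at h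
  have h3 : 3 * pdi i (root hreg) = 0 := by
    linear_combination rootInv hreg ^ 2 * h - 3 * pdi i (root hreg) *
      (root hreg * rootInv hreg + 1) * root_mul_rootInv hreg
  refine (smul_eq_zero_iff_right (three_ne_zero : (3 : ℝ) ≠ 0)).1 ?_
  rw [ofNat_smul_eq_nsmul, ← h3, nsmul_eq_mul]
  norm_num

/-- The algebra of smooth functions on `U` with the coordinates `x, y, y₁, y₂^{1/3}, z`. -/
def jetDerivations : JetDerivations (smoothFunctions U) where
  dx := pdi 0
  dy := pdi 1
  dp := pdi 2
  -- The chain rule for y₂ = r³ gives ∂_r = 3r²∂_{y₂}.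
  dr := (3 * root hreg ^ 2) • pdi 3
  dz := pdi 4
  x := coord 0
  y := coord 1
  p := coord 2
  r := root hreg
  s := rootInv hreg
  r_mul_s := root_mul_rootInv hreg
  dy_dx f := pd_comm _ _ f
  dp_dx f := pd_comm _ _ f
  dr_dx f := by simp [pdi_root_of_ne, JetDerivations.map_ofNat_eq_zero, pd_comm _ (Pi.single 3 1) f]
  dz_dx f := pd_comm _ _ f
  dp_dy f := pd_comm _ _ f
  dr_dy f := by simp [pdi_root_of_ne, JetDerivations.map_ofNat_eq_zero, pd_comm _ (Pi.single 3 1) f]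
  dz_dy f := pd_comm _ _ f
  dr_dp f := by simp [pdi_root_of_ne, JetDerivations.map_ofNat_eq_zero, pd_comm _ (Pi.single 3 1) f]
  dz_dp f := pd_comm _ _ f
  dr_dz f := by simp [pdi_root_of_ne, JetDerivations.map_ofNat_eq_zero, pd_comm _ (Pi.single 3 1) f]
  dx_x := pdi_coord 0 0
  dy_x := pdi_coord 1 0
  dp_x := pdi_coord 2 0
  dr_x := by simp [pdi_coord]
  dz_x := pdi_coord 4 0
  dx_y := pdi_coord 0 1
  dy_y := pdi_coord 1 1
  dp_y := pdi_coord 2 1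
  dr_y := by simp [pdi_coord]
  dz_y := pdi_coord 4 1
  dx_p := pdi_coord 0 2
  dy_p := pdi_coord 1 2
  dp_p := pdi_coord 2 2
  dr_p := by simp [pdi_coord]
  dz_p := pdi_coord 4 2
  dx_r := pdi_root_of_ne hreg (by decide)
  dy_r := pdi_root_of_ne hreg (by decide)
  dp_r := pdi_root_of_ne hreg (by decide)
  dr_r := pdi_root hreg 3
  dz_r := pdi_root_of_ne hreg (by decide)

end smoothFunctions

end CubeRoot

/-! ### Symmetries of the Monge distribution as determining equations -/

open smoothFunctions

/-- The vector field `∂/∂y₂`. -/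
def fieldW (_ : J20) : J20 := ![0, 0, 0, 1, 0]

/-- The total derivative of the Monge equation. -/
def fieldX (p : J20) : J20 := ![1, p 2, p 3, 0, mongeF p]

theorem mem_mongeDistribution_iff {p v : J20} :
    v ∈ mongeDistribution p ↔ v = v 3 • fieldW p + v 0 • fieldX p := by
  rw [mongeDistribution, Submodule.mem_span_pair]
  constructor
  · rintro ⟨a, b, rfl⟩
    simp [fieldW, fieldX]
  · intro h
    exact ⟨v 3, v 0, h.symm⟩

theorem mem_mongeDistribution_iff_coord {p v : J20} :
    v ∈ mongeDistribution p ↔ v 1 = p 2 * v 0 ∧ v 2 = p 3 * v 0 ∧ v 4 = mongeF p * v 0 := by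
  rw [mem_mongeDistribution_iff]
  constructor
  · intro h
    refine ⟨?_, ?_, ?_⟩
    · simpa [fieldW, fieldX, mul_comm] using congrFun h 1
    · simpa [fieldW, fieldX, mul_comm] using congrFun h 2
    · simpa [fieldW, fieldX, mul_comm] using congrFun h 4
  · rintro ⟨h1, h2, h4⟩
    ext i
    fin_cases i <;> simp [fieldW, fieldX, h1, h2, h4, mul_comm]

section

variable {U : Opens J20}

theorem contDiffOn_fieldW : ContDiffOn ℝ ∞ fieldW U := contDiffOn_const

variable (hreg : ∀ p ∈ U, p 3 ≠ 0)
include hreg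

theorem contDiffOn_mongeF : ContDiffOn ℝ ∞ mongeF U :=
  (contDiff_apply ℝ ℝ (1 : Fin 5)).contDiffOn.add (contDiffOn_cbrt hreg)

theorem contDiffOn_fieldX : ContDiffOn ℝ ∞ fieldX U := by
  rw [contDiffOn_pi]
  intro i
  fin_cases i
  · exact contDiffOn_const
  · exact (contDiff_apply ℝ ℝ (2 : Fin 5)).contDiffOn
  · exact (contDiff_apply ℝ ℝ (3 : Fin 5)).contDiffOn
  · exact contDiffOn_const
  · exact contDiffOn_mongeF hreg

omit hreg in
theorem comp_fieldW (i : Fin 5) :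
    comp (contDiffOn_fieldW (U := U)) i = ![0, 0, 0, 1, 0] i := by
  fin_cases i <;> exact ext fun p => rfl

theorem comp_fieldX (i : Fin 5) :
    comp (contDiffOn_fieldX hreg) i = ![1, coord 2, coord 3, 0, coord 1 + root hreg] i := by
  fin_cases i <;> exact ext fun p => rfl

omit hreg in
/-- Bracket of a vector field with a section of the Monge distribution. -/
theorem lieBracket_comb {S : J20 → J20} {m n : J20 → ℝ} {V W : J20 → J20} {p : J20}
    (hV : DifferentiableAt ℝ V p) (hW : DifferentiableAt ℝ W p)
    (hm : DifferentiableAt ℝ m p) (hn : DifferentiableAt ℝ n p) :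
    lieBracket ℝ S (fun q => m q • V q + n q • W q) p =
      fderiv ℝ m p (S p) • V p + m p • lieBracket ℝ S V p +
      (fderiv ℝ n p (S p) • W p + n p • lieBracket ℝ S W p) := by
  have h := lieBracket_add_right (𝕜 := ℝ) (V := S) (hm.smul hV) (hn.smul hW)
  have h1 := lieBracket_smul_right (V := S) hm hV
  have h2 := lieBracket_smul_right (V := S) hn hW
  exact h.trans (congrArg₂ (· + ·) h1 h2)

/-- A vector field is an infinitesimal symmetry iff its brackets with the generators of the
distribution lie in the distribution. -/
theorem isInfinitesimalSymmetry_iff {S : J20 → J20} :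
    IsInfinitesimalSymmetry mongeDistribution U S ↔ ∀ p ∈ U,
      lieBracket ℝ S fieldW p ∈ mongeDistribution p ∧
      lieBracket ℝ S fieldX p ∈ mongeDistribution p := by
  have hW (p : J20) : fieldW p ∈ mongeDistribution p := Submodule.subset_span (by simp [fieldW])
  have hX (p : J20) : fieldX p ∈ mongeDistribution p := Submodule.subset_span (by simp [fieldX])
  constructor
  · intro h p hp
    exact ⟨h U le_rfl _ contDiffOn_fieldW (fun q _ => hW q) p hp,
      h U le_rfl _ (contDiffOn_fieldX hreg) (fun q _ => hX q) p hp⟩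
  · intro h V hVU Y hY hYD p hp
    have hd {f : J20 → J20} (hf : ContDiffOn ℝ ∞ f U) : DifferentiableAt ℝ f p :=
      (hf.contDiffAt (U.isOpen.mem_nhds (hVU hp))).differentiableAt (by simp)
    have hYd (i : Fin 5) : DifferentiableAt ℝ (fun q => Y q i) p :=
      differentiableAt_pi.1
        ((hY.contDiffAt (V.isOpen.mem_nhds hp)).differentiableAt (by simp)) i
    -- The coefficients of a section are its own components 3 and 0, hence smooth. Their derivatives
    -- in the Leibniz rule only contribute multiples of the generators.
    have he : Y =ᶠ[nhds p] fun q => Y q 3 • fieldW q + Y q 0 • fieldX q :=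
      Filter.eventuallyEq_of_mem (V.isOpen.mem_nhds hp) fun q hq =>
        mem_mongeDistribution_iff.1 (hYD q hq)
    rw [(Filter.EventuallyEq.refl _ _).lieBracket_vectorField_eq he,
      lieBracket_comb (hd contDiffOn_fieldW) (hd (contDiffOn_fieldX hreg)) (hYd 3) (hYd 0)]
    exact add_mem (add_mem (Submodule.smul_mem _ _ (hW p)) (Submodule.smul_mem _ _ (h p (hVU hp)).1))
      (add_mem (Submodule.smul_mem _ _ (hX p)) (Submodule.smul_mem _ _ (h p (hVU hp)).2))

omit hreg in
theorem lieBracket_fieldW {S : J20 → J20} (hS : ContDiffOn ℝ ∞ S U) (p : U) (i : Fin 5) :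
    lieBracket ℝ S fieldW p i = ev p (-pdi 3 (comp hS i)) := by
  rw [comp_lieBracket hS contDiffOn_fieldW]
  congr 1
  simp only [comp_fieldW]
  fin_cases i <;> simp [Fin.sum_univ_five]

theorem lieBracket_fieldX {S : J20 → J20} (hS : ContDiffOn ℝ ∞ S U) (p : U) (i : Fin 5) :
    lieBracket ℝ S fieldX p i = ev p (![0, comp hS 2, comp hS 3, 0,
      comp hS 1 + comp hS 3 * pdi 3 (root hreg)] i - (jetDerivations hreg).X (comp hS i)) := by
  rw [comp_lieBracket hS (contDiffOn_fieldX hreg)]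
  congr 1
  have hX (f : smoothFunctions U) : (jetDerivations hreg).X f = pdi 0 f + coord 2 * pdi 1 f +
      coord 3 * pdi 2 f + (coord 1 + root hreg) * pdi 4 f := by
    rw [JetDerivations.X_apply, JetDerivations.D_apply, ← root_pow_three hreg]
    simp only [jetDerivations]
    ring
  simp only [comp_fieldX hreg, hX]
  fin_cases i <;>
    simp [Fin.sum_univ_five, pdi_coord, pdi_root_of_ne]

omit hreg in
theorem ev_ext_iff {f g : smoothFunctions U} : (∀ p : U, ev p f = ev p g) ↔ f = g :=
  ⟨fun h => ext h, fun h _ => h ▸ rfl⟩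

/-- Testing the brackets with ∂_{y₂} and with the total derivative against three annihilating forms
gives six equations. Multiplication by the unit 3r² turns ∂_{y₂} into ∂_r and clears ∂r/∂y₂ =
1/(3r²) from the last one. -/
theorem isInfinitesimalSymmetry_iff_determining {S : J20 → J20} (hS : ContDiffOn ℝ ∞ S U) :
    IsInfinitesimalSymmetry mongeDistribution U S ↔
      (jetDerivations hreg).Determining (comp hS) := by
  obtain ⟨J, hJ⟩ : ∃ J, J = jetDerivations hreg := ⟨_, rfl⟩
  obtain ⟨s, hs⟩ : ∃ s, s = comp hS := ⟨_, rfl⟩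
  have hF (p : U) : mongeF p = ev p (J.y + J.r) := by rw [hJ]; rfl
  have h2 (p : U) : p.1 2 = ev p J.p := by rw [hJ]; rfl
  have h3 (p : U) : p.1 3 = ev p (J.r ^ 3) := by rw [hJ]; exact (cbrt_pow_three (p.1 3)).symm
  have hr : root hreg = J.r := by rw [hJ]; rfl
  have hu : 3 * J.r ^ 2 * pdi 3 J.r = 1 := by rw [← hr]; exact pdi_root hreg 3
  have hcancel {f g : smoothFunctions U} : 3 * J.r ^ 2 * f = 3 * J.r ^ 2 * g ↔ f = g :=
    ⟨fun h => by linear_combination pdi 3 J.r * h - (f - g) * hu, fun h => by rw [h]⟩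
  have hdr (f : smoothFunctions U) : J.dr f = 3 * J.r ^ 2 * pdi 3 f := by rw [hJ]; rfl
  have hall : (∀ p ∈ U, lieBracket ℝ S fieldW p ∈ mongeDistribution p ∧
      lieBracket ℝ S fieldX p ∈ mongeDistribution p) ↔
      pdi 3 (s 1) = J.p * pdi 3 (s 0) ∧ pdi 3 (s 2) = J.r ^ 3 * pdi 3 (s 0) ∧
      pdi 3 (s 4) = (J.y + J.r) * pdi 3 (s 0) ∧
      s 2 - J.X (s 1) = -(J.p * J.X (s 0)) ∧ s 3 - J.X (s 2) = -(J.r ^ 3 * J.X (s 0)) ∧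
      s 1 + s 3 * pdi 3 J.r - J.X (s 4) = -((J.y + J.r) * J.X (s 0)) := by
    simp only [← ev_ext_iff, ← forall_and]
    rw [← Subtype.forall (p := (· ∈ U)) (q := fun p => lieBracket ℝ S fieldW p ∈
      mongeDistribution p ∧ lieBracket ℝ S fieldX p ∈ mongeDistribution p)]
    refine forall_congr' fun p => ?_
    simp only [mem_mongeDistribution_iff_coord, lieBracket_fieldW hS, lieBracket_fieldX hreg hS,
      hF, h2, h3, and_assoc, ← hJ, ← hs, hr]
    simp
  rw [isInfinitesimalSymmetry_iff hreg, hall, ← hJ, ← hs, JetDerivations.Determining]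
  simp only [hdr]
  rw [← hcancel (f := pdi 3 (s 1)), ← hcancel (f := pdi 3 (s 2)), ← hcancel (f := pdi 3 (s 4)),
    ← hcancel (f := s 1 + _ - _)]
  refine and_congr ?_ (and_congr ?_ (and_congr ?_ (and_congr_right' (and_congr_right' ?_))))
  · rw [mul_left_comm]
  · rw [mul_left_comm]
  · rw [mul_left_comm]
  · constructor <;> intro h
    · linear_combination h - s 3 * hu
    · linear_combination h + s 3 * hu

end

/-! ### The symmetry algebra and its basis -/

/-- The linear combination of `S₁, …, S₆` with coefficients `k`. -/
def combField (k : Fin 6 → ℝ) (p : J20) : J20 := combComp (p 0) (p 1) (p 2) (p 3) k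

theorem sum_smul_genField (k : Fin 6 → ℝ) (p : J20) :
    ∑ i, k i • genField i p = combField k p := by
  ext j
  fin_cases j <;> simp [Fin.sum_univ_six, genField, combField, combComp] <;> ring

/-- The linear combination of the vector fields `S₁, …, S₆` on `U`. -/
def combS (U : Opens J20) : (Fin 6 → ℝ) →ₗ[ℝ] SmoothVectorField U :=
  Fintype.linearCombination ℝ (S U)

variable {U : Opens J20}

theorem combS_apply (k : Fin 6 → ℝ) {p : J20} (hp : p ∈ U) : combS U k p = combField k p := by
  have h : combS U k = ∑ i, k i • S U i := Fintype.linearCombination_apply ..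
  rw [h, ← sum_smul_genField]
  have h1 := map_sum (SmoothVectorField.coeAddHom (U := U)) (fun i => k i • S U i) Finset.univ
  refine (congrFun h1 p).trans ?_
  rw [Finset.sum_apply]
  refine Finset.sum_congr rfl fun i _ => ?_
  change k i • (S U i) p = _
  exact congrArg (k i • ·) (indicator_of_mem (s := (U : Set J20)) hp (genField i))

theorem comp_eq_combComp_iff {X : J20 → J20} (hX : ContDiffOn ℝ ∞ X U) (k : Fin 6 → ℝ) :
    comp hX = combComp (coord 0) (coord 1) (coord 2) (coord 3) k ↔
      ∀ p ∈ U, X p = combField k p := by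
  constructor
  · intro h p hp
    ext i
    rw [← ev_comp hX i ⟨p, hp⟩, h, map_combComp]
    rfl
  · intro h
    ext1 i
    refine ext fun p => ?_
    rw [← ev_apply, ← ev_apply, ev_comp, h p p.2, map_combComp]
    rfl

theorem algebraMap_injective (hU : (U : Set J20).Nonempty) (a : ℝ)
    (h : algebraMap ℝ (smoothFunctions U) a = 0) : a = 0 := by
  obtain ⟨q, hq⟩ := hU
  have := congrArg (ev ⟨q, hq⟩) h
  rwa [AlgHom.commutes, map_zero] at this

theorem comp_combS (k : Fin 6 → ℝ) :
    comp (combS U k).smooth' = combComp (coord 0) (coord 1) (coord 2) (coord 3) k :=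
  (comp_eq_combComp_iff (combS U k).smooth' k).2 fun _ hp => combS_apply k hp

theorem combS_injective (hU : (U : Set J20).Nonempty) (hreg : ∀ p ∈ U, p 3 ≠ 0) :
    Function.Injective (combS U) := by
  rw [← LinearMap.ker_eq_bot, LinearMap.ker_eq_bot']
  intro k hk
  refine (jetDerivations hreg).eq_zero_of_combComp (q := coord 3) (algebraMap_injective hU)
    ((comp_combS k).symm.trans (funext fun i => ext fun p => ?_))
  rw [← ev_apply, ev_comp, hk]
  rfl

/-- A linear combination of `S₁, …, S₆` that is tangent to the fibres of the projection to `J²`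
is a multiple of `S₆`. -/
theorem coeff_eq_zero_of_combS (hU : (U : Set J20).Nonempty) (hreg : ∀ p ∈ U, p 3 ≠ 0)
    {k : Fin 6 → ℝ} (h : ∀ p ∈ U, proj (combS U k p) = 0) : ∀ i ≠ 5, k i = 0 := by
  refine (jetDerivations hreg).coeff_eq_zero_of_combComp (q := coord 3) (algebraMap_injective hU)
    ((congrFun (comp_combS k) 0).symm.trans (ext fun p => ?_))
    ((congrFun (comp_combS k) 1).symm.trans (ext fun p => ?_))
  · exact congrFun (h p p.2) 0
  · exact congrFun (h p p.2) 1

/-- The classification of symmetries; later statements about the symmetry algebra are reduced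
through it to computations with k ∈ ℝ⁶. -/
theorem mem_symmetryAlgebra_iff (hU : IsPreconnected (U : Set J20)) (hreg : ∀ p ∈ U, p 3 ≠ 0)
    (X : SmoothVectorField U) :
    X ∈ symmetryAlgebra mongeDistribution U ↔ ∃ k, X = combS U k := by
  have h : X ∈ symmetryAlgebra mongeDistribution U ↔
      IsInfinitesimalSymmetry mongeDistribution U X := Iff.rfl
  have h3 : (jetDerivations hreg).r ^ 3 = coord 3 := root_pow_three hreg
  rw [h, isInfinitesimalSymmetry_iff_determining hreg X.smooth']
  constructor
  · intro hd
    obtain ⟨k, hk⟩ := hd.exists_combComp (fun f f0 f1 f2 f3 f4 => by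
        refine exists_const hU f fun i => ?_
        have f3' : 3 * root hreg ^ 2 * pdi 3 f = 0 := f3
        have hr : 3 * root hreg ^ 2 * pdi 3 (root hreg) = 1 := pdi_root hreg 3
        fin_cases i
        · exact f0
        · exact f1
        · exact f2
        -- The hypothesis concerns ∂_r = 3r²∂_{y₂}; its factor 3r² has inverse ∂r/∂y₂.
        · change pdi 3 f = 0
          linear_combination pdi 3 (root hreg) * f3' - pdi 3 f * hr
        · exact f4)
    rw [h3] at hk
    exact ⟨k, SmoothVectorField.ext_on fun p hp => by
      rw [combS_apply k hp]
      exact (comp_eq_combComp_iff X.smooth' k).1 hk p hp⟩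
  · rintro ⟨k, rfl⟩
    have hd := (jetDerivations hreg).determining_combComp k
    rw [h3] at hd
    rwa [comp_combS]

theorem symmetryAlgebra_toSubmodule (hU : IsPreconnected (U : Set J20))
    (hreg : ∀ p ∈ U, p 3 ≠ 0) :
    (symmetryAlgebra mongeDistribution U).toSubmodule = LinearMap.range (combS U) := by
  ext X
  rw [LieSubalgebra.mem_toSubmodule, mem_symmetryAlgebra_iff hU hreg, LinearMap.mem_range]
  simp only [eq_comm]

theorem range_combS : LinearMap.range (combS U) = Submodule.span ℝ (range (S U)) :=
  Fintype.range_linearCombination ℝ (S U)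

theorem linearIndependent_S (hU : (U : Set J20).Nonempty) (hreg : ∀ p ∈ U, p 3 ≠ 0) :
    LinearIndependent ℝ (S U) :=
  linearIndependent_iff_injective_fintypeLinearCombination.2 (combS_injective hU hreg)

theorem lie_combS (k l : Fin 6 → ℝ) : ⁅combS U k, combS U l⁆ = combS U (combBracket k l) := by
  refine SmoothVectorField.ext_on fun p hp => ?_
  ext i
  rw [combS_apply _ hp, SmoothVectorField.bracket_apply _ _ hp]
  refine (comp_lieBracket (combS U k).smooth' (combS U l).smooth' i ⟨p, hp⟩).trans ?_
  simp only [comp_combS]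
  have h := bracket_combComp (A := smoothFunctions U) pdi coord pdi_coord k l i
  rw [h, map_combComp, combField]
  simp only [ev_coord]

/-! ### Genericity of the distribution -/

/-- The bracket of `∂/∂y₂` with the total derivative. -/
def fieldY (p : J20) : J20 := ![0, 0, 1, 0, (3 * cbrt (p 3) ^ 2)⁻¹]

/-- Linear forms whose common kernel at `p` is the Monge distribution, and of which the first and
the last also vanish on `fieldY p`. -/
def coframe (p : J20) : J20 →ₗ[ℝ] (Fin 3 → ℝ) where
  toFun v := ![v 1 - p 2 * v 0, v 2 - p 3 * v 0,
    v 4 - mongeF p * v 0 - (3 * cbrt (p 3) ^ 2)⁻¹ * (v 2 - p 3 * v 0)]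
  map_add' v w := by ext i; fin_cases i <;> simp <;> ring
  map_smul' c v := by ext i; fin_cases i <;> simp <;> ring

theorem coframe_fieldW (p : J20) : coframe p (fieldW p) = 0 := by
  ext i; fin_cases i <;> simp [coframe, fieldW]

theorem coframe_fieldX (p : J20) : coframe p (fieldX p) = 0 := by
  ext i; fin_cases i <;> simp [coframe, fieldX]

theorem coframe_fieldY (p : J20) : coframe p (fieldY p) = ![0, 1, 0] := by
  ext i; fin_cases i <;> simp [coframe, fieldY]

section

variable {U : Opens J20} (hreg : ∀ p ∈ U, p 3 ≠ 0)
include hreg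

theorem ev_pdi_root (p : U) : ev p (pdi 3 (root hreg)) = (3 * cbrt (p.1 3) ^ 2)⁻¹ := by
  have h : 3 * root hreg ^ 2 * pdi 3 (root hreg) = 1 := pdi_root hreg 3
  have h1 := congrArg (ev p) h
  simp only [map_mul, map_pow, map_one, map_ofNat] at h1
  exact eq_inv_of_mul_eq_one_right h1

/-- Differentiating 3r²r' = 1 gives 6r r'² + 3r²r'' = 0, so r'' = 0 would force r r' = 0, contrary
to 3r²r' = 1. -/
theorem ev_pdi_pdi_root_ne_zero (p : U) : ev p (pdi 3 (pdi 3 (root hreg))) ≠ 0 := by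
  have h : 3 * root hreg ^ 2 * pdi 3 (root hreg) = 1 := pdi_root hreg 3
  have h1 := congrArg (ev p) h
  have h2 := congrArg (fun f => ev p (pdi 3 f)) h
  simp only [Derivation.leibniz, Derivation.leibniz_pow, JetDerivations.map_ofNat_eq_zero,
    Derivation.map_one_eq_zero, map_add, map_mul, map_pow, map_one, map_zero, map_ofNat,
    smul_eq_mul, nsmul_eq_mul] at h1 h2
  have h3 : ev p (root hreg) ≠ 0 := fun h0 => by simp [h0] at h1
  have h4 : ev p (pdi 3 (root hreg)) ≠ 0 := fun h0 => by simp [h0] at h1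
  intro h0
  rw [h0] at h2
  have e2 : ev p (2 : smoothFunctions U) = 2 := map_ofNat _ 2
  norm_num [e2, h3, h4] at h2

theorem contDiffOn_fieldY : ContDiffOn ℝ ∞ fieldY U := by
  rw [contDiffOn_pi]
  intro i
  fin_cases i
  · exact contDiffOn_const
  · exact contDiffOn_const
  · exact contDiffOn_const
  · exact contDiffOn_const
  · exact (contDiffOn_const.mul ((contDiffOn_cbrt hreg).pow 2)).inv fun p hp =>
      mul_ne_zero three_ne_zero (pow_ne_zero 2 (cbrt_ne_zero (hreg p hp)))

theorem comp_fieldY (i : Fin 5) :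
    comp (contDiffOn_fieldY hreg) i = ![0, 0, 1, 0, pdi 3 (root hreg)] i := by
  fin_cases i <;> refine ext fun p => ?_
  · rfl
  · rfl
  · rfl
  · rfl
  · exact (ev_pdi_root hreg p).symm

theorem lieBracket_fieldW_fieldX {p : J20} (hp : p ∈ U) :
    lieBracket ℝ fieldW fieldX p = fieldY p := by
  ext i
  have h := lieBracket_fieldX hreg (contDiffOn_fieldW (U := U)) ⟨p, hp⟩ i
  simp only [comp_fieldW] at h
  rw [h]
  fin_cases i <;> simp [fieldY, ev_pdi_root hreg ⟨p, hp⟩]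

theorem lieBracket_fieldY_fieldW {p : J20} (hp : p ∈ U) :
    lieBracket ℝ fieldY fieldW p =
      ![0, 0, 0, 0, -ev ⟨p, hp⟩ (pdi 3 (pdi 3 (root hreg)))] := by
  ext i
  have h := lieBracket_fieldW (contDiffOn_fieldY hreg) ⟨p, hp⟩ i
  simp only [comp_fieldY hreg] at h
  rw [h]
  fin_cases i <;> simp

theorem lieBracket_fieldY_fieldX {p : J20} (hp : p ∈ U) :
    lieBracket ℝ fieldY fieldX p = ![0, 1, 0, 0, 0] := by
  ext i
  have h := lieBracket_fieldX hreg (contDiffOn_fieldY hreg) ⟨p, hp⟩ i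
  simp only [comp_fieldY hreg] at h
  rw [h]
  have hX : (jetDerivations hreg).X (pdi 3 (root hreg)) = 0 := by
    rw [JetDerivations.X_apply, JetDerivations.D_apply]
    simp only [jetDerivations]
    have hc (i : Fin 5) : pdi i (pdi 3 (root hreg)) = pdi 3 (pdi i (root hreg)) := pd_comm _ _ _
    simp [hc, pdi_root_of_ne]
  fin_cases i <;> simp [hX]

omit hreg in
theorem section_eventuallyEq {V : Opens J20} {X : J20 → J20}
    (hX : ∀ q ∈ V, X q ∈ mongeDistribution q) {p : J20} (hp : p ∈ V) :
    X =ᶠ[nhds p] fun q => X q 3 • fieldW q + X q 0 • fieldX q :=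
  Filter.eventuallyEq_of_mem (V.isOpen.mem_nhds hp) fun q hq =>
    mem_mongeDistribution_iff.1 (hX q hq)

omit hreg in
theorem differentiableAt_of_contDiffOn {V : Opens J20} {X : J20 → J20}
    (hX : ContDiffOn ℝ ∞ X V) {p : J20} (hp : p ∈ V) : DifferentiableAt ℝ X p :=
  (hX.contDiffAt (V.isOpen.mem_nhds hp)).differentiableAt (by simp)

omit hreg in
-- Modulo the distribution the bracket with T is linear over functions in its section argument,
-- because the Leibniz terms lie in the distribution.
theorem coframe_lieBracket_section {V : Opens J20} (hV : ∀ p ∈ V, p 3 ≠ 0) {X T : J20 → J20}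
    (hX : ContDiffOn ℝ ∞ X V) (hXD : ∀ q ∈ V, X q ∈ mongeDistribution q) {p : J20} (hp : p ∈ V) :
    coframe p (lieBracket ℝ T X p) = X p 3 • coframe p (lieBracket ℝ T fieldW p) +
      X p 0 • coframe p (lieBracket ℝ T fieldX p) := by
  have hXd := differentiableAt_pi.1 (differentiableAt_of_contDiffOn hX hp)
  rw [(Filter.EventuallyEq.refl _ _).lieBracket_vectorField_eq (section_eventuallyEq hXD hp),
    lieBracket_comb (differentiableAt_of_contDiffOn contDiffOn_fieldW hp)
      (differentiableAt_of_contDiffOn (contDiffOn_fieldX hV) hp) (hXd 3) (hXd 0)]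
  simp only [map_add, map_smul, coframe_fieldW, coframe_fieldX, smul_zero, zero_add]

omit hreg in
theorem coframe_eq_zero_iff {p v : J20} : coframe p v = 0 ↔ v ∈ mongeDistribution p := by
  rw [mem_mongeDistribution_iff_coord]
  constructor
  · intro h
    have h0 : v 1 - p 2 * v 0 = 0 := congrFun h 0
    have h1 : v 2 - p 3 * v 0 = 0 := congrFun h 1
    have h2 : v 4 - mongeF p * v 0 - (3 * cbrt (p 3) ^ 2)⁻¹ * (v 2 - p 3 * v 0) = 0 := congrFun h 2
    rw [h1, mul_zero, sub_zero] at h2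
    exact ⟨sub_eq_zero.1 h0, sub_eq_zero.1 h1, sub_eq_zero.1 h2⟩
  · rintro ⟨h0, h1, h2⟩
    ext i
    fin_cases i <;> simp [coframe, h0, h1, h2]

section Frame

variable {X₁ X₂ : J20 → J20}

/-- Expanding both sections in the generators leaves the determinant of their coefficients times
[∂_{y₂}, X], by antisymmetry. -/
theorem coframe_lieBracket_sections (h1 : ContDiffOn ℝ ∞ X₁ U) (h2 : ContDiffOn ℝ ∞ X₂ U)
    (hD1 : ∀ q ∈ U, X₁ q ∈ mongeDistribution q) (hD2 : ∀ q ∈ U, X₂ q ∈ mongeDistribution q)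
    {p : J20} (hp : p ∈ U) :
    coframe p (lieBracket ℝ X₁ X₂ p) =
      (X₁ p 3 * X₂ p 0 - X₁ p 0 * X₂ p 3) • ![0, 1, 0] := by
  rw [coframe_lieBracket_section hreg h2 hD2 hp, lieBracket_swap (W := fieldW),
    lieBracket_swap (W := fieldX), map_neg, map_neg,
    coframe_lieBracket_section hreg h1 hD1 hp, coframe_lieBracket_section hreg h1 hD1 hp,
    lieBracket_self, lieBracket_self, lieBracket_swap (V := fieldX) (W := fieldW),
    lieBracket_fieldW_fieldX hreg hp, map_neg, coframe_fieldY]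
  simp only [Pi.zero_apply, map_zero, smul_zero, zero_add, add_zero]
  module

theorem coframe_lieBracket_fieldY {p : J20} (hp : p ∈ U) (h1 : ContDiffOn ℝ ∞ X₁ U)
    (hD1 : ∀ q ∈ U, X₁ q ∈ mongeDistribution q) :
    coframe p (lieBracket ℝ X₁ fieldY p) =
      ![-X₁ p 0, 0, X₁ p 3 * ev ⟨p, hp⟩ (pdi 3 (pdi 3 (root hreg)))] := by
  rw [lieBracket_swap, map_neg, coframe_lieBracket_section hreg h1 hD1 hp,
    lieBracket_fieldY_fieldW hreg hp, lieBracket_fieldY_fieldX hreg hp]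
  ext i
  fin_cases i <;> simp [coframe]

/-- The second brackets of sections of the Monge distribution. -/
theorem coframe_lieBracket_lieBracket (h1 : ContDiffOn ℝ ∞ X₁ U) (h2 : ContDiffOn ℝ ∞ X₂ U)
    (hD1 : ∀ q ∈ U, X₁ q ∈ mongeDistribution q) (hD2 : ∀ q ∈ U, X₂ q ∈ mongeDistribution q)
    {X : J20 → J20} (hX : ContDiffOn ℝ ∞ X U) (hD : ∀ q ∈ U, X q ∈ mongeDistribution q)
    {p : J20} (hp : p ∈ U) :
    ∃ a : ℝ, coframe p (lieBracket ℝ X (lieBracket ℝ X₁ X₂) p) =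
      ![(X₁ p 3 * X₂ p 0 - X₁ p 0 * X₂ p 3) * -X p 0, a,
        (X₁ p 3 * X₂ p 0 - X₁ p 0 * X₂ p 3) *
          (X p 3 * ev ⟨p, hp⟩ (pdi 3 (pdi 3 (root hreg))))] := by
  have hd {f : J20 → J20} (hf : ContDiffOn ℝ ∞ f U) : DifferentiableAt ℝ f p :=
    differentiableAt_of_contDiffOn hf hp
  obtain ⟨Z, hZ⟩ : ∃ Z, Z = lieBracket ℝ X₁ X₂ := ⟨_, rfl⟩
  have hZs : ContDiffOn ℝ ∞ Z U := hZ ▸ contDiffOn_lieBracket h1 h2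
  obtain ⟨Δ, hΔ⟩ : ∃ Δ : J20 → ℝ, Δ = fun q => X₁ q 3 * X₂ q 0 - X₁ q 0 * X₂ q 3 := ⟨_, rfl⟩
  have hΔs : ContDiffOn ℝ ∞ Δ U := by
    have c1 := contDiffOn_pi.1 h1
    have c2 := contDiffOn_pi.1 h2
    rw [hΔ]
    exact ((c1 3).mul (c2 0)).sub ((c1 0).mul (c2 3))
  have hYs := contDiffOn_fieldY hreg
  -- [X₁, X₂] = R + Δ Y with R a section of the distribution. Both [X, R] and the derivative of Δ
  -- contribute only to the middle component of `coframe`, whose value is left unspecified; the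
  -- outer ones come from Δ[X, Y].
  have hRs : ContDiffOn ℝ ∞ (Z - Δ • fieldY) U := hZs.sub (hΔs.smul hYs)
  have hRD : ∀ q ∈ U, (Z - Δ • fieldY) q ∈ mongeDistribution q := fun q hq => by
    rw [← coframe_eq_zero_iff, Pi.sub_apply, Pi.smul_apply', map_sub, map_smul, coframe_fieldY, hZ,
      coframe_lieBracket_sections hreg h1 h2 hD1 hD2 hq, hΔ, sub_self]
  have hΔd : DifferentiableAt ℝ Δ p :=
    (hΔs.contDiffAt (U.isOpen.mem_nhds hp)).differentiableAt (by simp)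
  have hsplit : lieBracket ℝ X Z p = lieBracket ℝ X (Z - Δ • fieldY) p +
      (fderiv ℝ Δ p (X p) • fieldY p + Δ p • lieBracket ℝ X fieldY p) := by
    rw [← lieBracket_smul_right (V := X) hΔd (hd hYs)]
    refine Eq.trans ?_ (lieBracket_add_right (hd hRs) (hΔd.smul (hd hYs)))
    congr 1
    exact (sub_add_cancel Z (Δ • fieldY)).symm
  refine ⟨coframe p (lieBracket ℝ X (lieBracket ℝ X₁ X₂) p) 1, ?_⟩
  rw [← hZ, hsplit, map_add, map_add, map_smul, map_smul, coframe_fieldY,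
    coframe_lieBracket_sections hreg hX hRs hD hRD hp, coframe_lieBracket_fieldY hreg hp hX hD, hΔ]
  ext i
  fin_cases i
  · simp
  · rfl
  · simp

end Frame

theorem isGeneric_mongeDistribution : IsGeneric mongeDistribution U := by
  constructor
  · intro p hp
    refine ⟨U, hp, le_rfl, fieldW, fieldX, contDiffOn_fieldW, contDiffOn_fieldX hreg,
      fun q _ => ⟨?_, rfl⟩⟩
    rw [LinearIndependent.pair_iff]
    intro s t h
    have h0 := congrFun h 0
    have h3 := congrFun h 3
    simp [fieldW, fieldX] at h0 h3
    exact ⟨h3, h0⟩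
  · intro V hVU X₁ X₂ ⟨h1, h2, hF⟩ p hp
    have hV : ∀ q ∈ V, q 3 ≠ 0 := fun q hq => hreg q (hVU hq)
    have hD1 : ∀ q ∈ V, X₁ q ∈ mongeDistribution q := fun q hq => by
      rw [← (hF q hq).2]; exact Submodule.subset_span (by simp)
    have hD2 : ∀ q ∈ V, X₂ q ∈ mongeDistribution q := fun q hq => by
      rw [← (hF q hq).2]; exact Submodule.subset_span (by simp)
    have hpair := LinearIndependent.pair_iff.1 (hF p hp).1
    have e1 := mem_mongeDistribution_iff.1 (hD1 p hp)
    have e2 := mem_mongeDistribution_iff.1 (hD2 p hp)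
    have hρ := ev_pdi_pdi_root_ne_zero hV ⟨p, hp⟩
    have c3 := coframe_lieBracket_sections hV h1 h2 hD1 hD2 hp
    obtain ⟨a, c4⟩ := coframe_lieBracket_lieBracket hV h1 h2 hD1 hD2 h1 hD1 hp
    obtain ⟨b, c5⟩ := coframe_lieBracket_lieBracket hV h1 h2 hD1 hD2 h2 hD2 hp
    generalize ev (⟨p, hp⟩ : V) (pdi 3 (pdi 3 (root hV))) = ρ at hρ c4 c5
    -- By Cramer's rule, Δ = 0 yields two relations between X₁ and X₂. Their independence kills both
    -- coefficients of X₁, hence X₁ itself.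
    have hΔ : X₁ p 3 * X₂ p 0 - X₁ p 0 * X₂ p 3 ≠ 0 := fun h => by
      have k1 := hpair (X₂ p 0) (-X₁ p 0) (by
        linear_combination (norm := module) (X₂ p 0) • e1 - (X₁ p 0) • e2 + h • fieldW p)
      have k2 := hpair (X₂ p 3) (-X₁ p 3) (by
        linear_combination (norm := module) (X₂ p 3) • e1 - (X₁ p 3) • e2 - h • fieldX p)
      rw [neg_eq_zero.1 k1.2, neg_eq_zero.1 k2.2, zero_smul, zero_smul, zero_add] at e1
      exact one_ne_zero (hpair 1 0 (by rw [e1, smul_zero, zero_smul, zero_add])).1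
    generalize X₁ p 3 * X₂ p 0 - X₁ p 0 * X₂ p 3 = Δ at hΔ c3 c4 c5
    have hli : LinearIndependent ℝ ![X₁ p, X₂ p, lieBracket ℝ X₁ X₂ p,
        lieBracket ℝ X₁ (lieBracket ℝ X₁ X₂) p, lieBracket ℝ X₂ (lieBracket ℝ X₁ X₂) p] := by
      rw [Fintype.linearIndependent_iff]
      intro t ht
      rw [Fin.sum_univ_five] at ht
      change t 0 • X₁ p + t 1 • X₂ p + t 2 • lieBracket ℝ X₁ X₂ p +
        t 3 • lieBracket ℝ X₁ (lieBracket ℝ X₁ X₂) p +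
        t 4 • lieBracket ℝ X₂ (lieBracket ℝ X₁ X₂) p = 0 at ht
      -- The outer components vanish on X₁, X₂ and [X₁, X₂]; after cancelling Δ and ρ they say that
      -- t₃X₁ + t₄X₂ = 0. The middle component then gives t₂ = 0.
      have hc := congrArg (coframe p) ht
      simp only [map_add, map_smul, map_zero, coframe_eq_zero_iff.2 (hD1 p hp),
        coframe_eq_zero_iff.2 (hD2 p hp), c3, c4, c5] at hc
      have hc0 := congrFun hc 0
      have hc1 := congrFun hc 1
      have hc2 := congrFun hc 2
      simp at hc0 hc1 hc2
      have d0 : t 3 * X₁ p 0 + t 4 * X₂ p 0 = 0 :=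
        (mul_eq_zero.1 (by linear_combination -hc0 : Δ * _ = 0)).resolve_left hΔ
      have d3 : t 3 * X₁ p 3 + t 4 * X₂ p 3 = 0 :=
        (mul_eq_zero.1 (by linear_combination hc2 : (Δ * ρ) * _ = 0)).resolve_left
          (mul_ne_zero hΔ hρ)
      obtain ⟨t3, t4⟩ := hpair (t 3) (t 4) (by
        linear_combination (norm := module) (t 3) • e1 + (t 4) • e2 + d3 • fieldW p + d0 • fieldX p)
      have t2 : t 2 = 0 := by simpa [t3, t4, hΔ] using hc1
      obtain ⟨t0, t1⟩ := hpair (t 0) (t 1) (by simpa [t2, t3, t4] using ht)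
      intro i
      fin_cases i <;> assumption
    exact ⟨hli, hli.span_eq_top_of_card_eq_finrank (by simp)⟩
end

/-! ### The isomorphism with sl(2) ⋉ n₃ -/

section SemidirectSum

/-- The coefficients with respect to `S₁, …, S₆` of the vector field of an element of
`sl(2) ⋉ n₃`. -/
def sl2n3Coeff : Sl2N3 →ₗ[ℝ] (Fin 6 → ℝ) where
  -- The field p ↦ Ap corresponds to the transpose of A, since A ↦ (p ↦ Ap) reverses brackets.
  -- Translations then carry the dual representation, and the area form, sending (k₃, k₄) to (k₄,
  -- -k₃), makes it the standard one; hence the sign and the swap.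
  toFun x := ![x.right.1 0 1, x.right.1 0 0, x.right.1 1 0, -x.left.1 1 2, x.left.1 0 1,
    x.left.1 0 2]
  map_add' x y := by
    ext i; fin_cases i <;> simp; ring
  map_smul' c x := by
    ext i; fin_cases i <;> simp

theorem sl_one_one (a : LieAlgebra.SpecialLinear.sl (Fin 2) ℝ) : a.1 1 1 = -a.1 0 0 := by
  have := LinearMap.mem_ker.1 a.2
  have h : a.1 0 0 + a.1 1 1 = 0 := by simpa [Matrix.trace_fin_two] using this
  linarith

theorem sl2n3Coeff_bijective : Function.Bijective sl2n3Coeff := by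
  constructor
  · intro x y h
    have h (i : Fin 6) : sl2n3Coeff x i = sl2n3Coeff y i := congrFun h i
    have h0 : x.right.1 0 1 = y.right.1 0 1 := h 0
    have h1 : x.right.1 0 0 = y.right.1 0 0 := h 1
    have h2 : x.right.1 1 0 = y.right.1 1 0 := h 2
    refine LieAlgebra.SemiDirectSum.ext (n3_ext (h 4) (neg_injective (h 3)) (h 5))
      (Subtype.ext ?_)
    ext i j
    fin_cases i <;> fin_cases j
    · exact h1
    · exact h0
    · exact h2
    · exact (sl_one_one _).trans ((congrArg Neg.neg h1).trans (sl_one_one _).symm)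
  · intro k
    refine ⟨⟨n3Mk (k 4) (-k 3) (k 5), ⟨!![k 1, k 0; k 2, -k 1], ?_⟩⟩, ?_⟩
    · exact LinearMap.mem_ker.2 (by simp [Matrix.trace_fin_two])
    · ext i
      fin_cases i <;> simp [sl2n3Coeff, n3Mk]

theorem sl2n3Coeff_lie (x y : Sl2N3) :
    sl2n3Coeff ⁅x, y⁆ = combBracket (sl2n3Coeff x) (sl2n3Coeff y) := by
  have hc (z : Sl2N3) : sl2n3Coeff z = ![z.right.1 0 1, z.right.1 0 0, z.right.1 1 0,
    -z.left.1 1 2, z.left.1 0 1, z.left.1 0 2] := rfl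
  have hr : ⁅x, y⁆.right.1 = x.right.1 * y.right.1 - y.right.1 * x.right.1 := rfl
  have hl : ⁅x, y⁆.left = ⁅x.left, y.left⁆ + n3Mk (x.right.1 0 0 * y.left.1 0 1 +
      x.right.1 0 1 * y.left.1 1 2) (x.right.1 1 0 * y.left.1 0 1 + x.right.1 1 1 * y.left.1 1 2) 0 -
      n3Mk (y.right.1 0 0 * x.left.1 0 1 + y.right.1 0 1 * x.left.1 1 2)
        (y.right.1 1 0 * x.left.1 0 1 + y.right.1 1 1 * x.left.1 1 2) 0 := rfl
  rw [hc ⁅x, y⁆, hc x, hc y, hr, hl, n3_bracket]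
  ext i
  fin_cases i <;>
    simp [combBracket, n3Mk, Matrix.mul_apply, Fin.sum_univ_two, sl_one_one] <;> ring

theorem nonempty_symmetryAlgebra_equiv {U : Opens J20} (hU : IsConnected (U : Set J20))
    (hreg : ∀ p ∈ U, p 3 ≠ 0) :
    Nonempty (symmetryAlgebra mongeDistribution U ≃ₗ⁅ℝ⁆ Sl2N3) := by
  let f : Sl2N3 →ₗ⁅ℝ⁆ symmetryAlgebra mongeDistribution U :=
    { toFun := fun x => ⟨combS U (sl2n3Coeff x),
        (mem_symmetryAlgebra_iff hU.isPreconnected hreg _).2 ⟨_, rfl⟩⟩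
      map_add' := fun x y => Subtype.ext
        (show combS U (sl2n3Coeff (x + y)) = _ + _ by rw [map_add, map_add])
      map_smul' := fun c x => Subtype.ext
        (show combS U (sl2n3Coeff (c • x)) = c • _ by rw [map_smul, map_smul])
      map_lie' := fun {x y} => Subtype.ext
        (show combS U (sl2n3Coeff ⁅x, y⁆) = ⁅combS U _, combS U _⁆ by
          rw [sl2n3Coeff_lie, ← lie_combS]) }
  refine ⟨(LieEquiv.ofBijective f ⟨fun x y h => ?_, fun X => ?_⟩).symm⟩
  · exact sl2n3Coeff_bijective.1 (combS_injective hU.nonempty hreg (congrArg Subtype.val h))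
  · obtain ⟨k, hk⟩ := (mem_symmetryAlgebra_iff hU.isPreconnected hreg X.1).1 X.2
    obtain ⟨x, rfl⟩ := sl2n3Coeff_bijective.2 k
    exact ⟨x, Subtype.ext hk.symm⟩

end SemidirectSum

/-! ### The fibration, projected fields and prolongation -/

section Fibration

variable {U : Opens J20}

theorem mem_vertical_iff {p v : J20} : v ∈ vertical p ↔ ∀ i : Fin 5, i ≠ 4 → v i = 0 := by
  rw [vertical, LinearMap.mem_ker]
  constructor
  · intro h i hi
    fin_cases i
    · exact congrFun h 0
    · exact congrFun h 1
    · exact congrFun h 2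
    · exact congrFun h 3
    · exact absurd rfl hi
  · intro h
    ext i
    fin_cases i <;> exact h _ (by decide)

/-- The first four components of the field do not depend on z, and a vertical field differentiates
only along z. -/
theorem combS_mem_symmetryAlgebra_vertical (k : Fin 6 → ℝ) :
    combS U k ∈ symmetryAlgebra vertical U := by
  intro V hV Y hY hYD p hp
  rw [mem_vertical_iff]
  intro i hi
  have hS : ContDiffOn ℝ ∞ (combS U k) V := (combS U k).smooth'.mono hV
  have hc := (comp_eq_combComp_iff hS k).2 fun p hp => combS_apply k (hV hp)
  have hY0 (j : Fin 5) (hj : j ≠ 4) : comp hY j = 0 := ext fun q => by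
    rw [← ev_apply, ev_comp, mem_vertical_iff.1 (hYD q q.2) j hj]; rfl
  have hk : pdi 4 (comp hS i) = 0 := by
    rw [hc]
    fin_cases i
    · simp [combComp, pdi_coord]
    · simp [combComp, pdi_coord]
    · simp [combComp, pdi_coord]
    · simp [combComp, pdi_coord]
    · exact absurd rfl hi
  refine (comp_lieBracket hS hY i ⟨p, hp⟩).trans ?_
  rw [hY0 i hi, Fin.sum_univ_five (f := fun j => comp hY j * _), hk, hY0 0 (by decide),
    hY0 1 (by decide), hY0 2 (by decide), hY0 3 (by decide)]
  simp

/-- The projection to `J²` of the linear combination of `S₁, …, S₆` with coefficients `k`. -/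
def projField (k : Fin 6 → ℝ) (q : J2) : J2 :=
  ![k 1 * q 0 + k 2 * q 1 + k 3, k 0 * q 0 - k 1 * q 1 + k 4,
    k 0 - 2 * k 1 * q 2 - k 2 * q 2 ^ 2, -(3 * k 1) * q 3 - 3 * k 2 * (q 2 * q 3)]

theorem contDiff_projField (k : Fin 6 → ℝ) : ContDiff ℝ ∞ (projField k) := by
  rw [contDiff_pi]
  intro j
  fin_cases j <;> simp [projField] <;> fun_prop

theorem proj_combField (k : Fin 6 → ℝ) (p : J20) :
    proj (combField k p) = projField k (proj p) := by
  ext i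
  fin_cases i <;> simp [proj, combField, combComp, projField]

theorem exists_mem_of_mem_projOpens {q : J2} (hq : q ∈ projOpens U) : ∃ p ∈ U, proj p = q := hq

theorem proj_mem_projOpens {p : J20} (hp : p ∈ U) : proj p ∈ projOpens U := mem_image_of_mem _ hp

theorem ext_projOpens {T T' : SmoothVectorField (projOpens U)}
    (h : ∀ p ∈ U, T (proj p) = T' (proj p)) : T = T' :=
  SmoothVectorField.ext_on fun q hq => by
    obtain ⟨p, hp, rfl⟩ := exists_mem_of_mem_projOpens hq
    exact h p hp

/-- Brackets of projectable vector fields are projectable. -/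
theorem proj_lie {X Y : SmoothVectorField U} {T T' : SmoothVectorField (projOpens U)}
    (hX : ∀ p ∈ U, T (proj p) = proj (X p)) (hY : ∀ p ∈ U, T' (proj p) = proj (Y p)) :
    ∀ p ∈ U, ⁅T, T'⁆ (proj p) = proj (⁅X, Y⁆ p) := by
  -- The chain rule applied to T' ∘ π = π ∘ Y, evaluated on X; the bracket is the difference of two
  -- such terms.
  have key {X Y : SmoothVectorField U} {T T' : SmoothVectorField (projOpens U)}
      (hX : ∀ p ∈ U, T (proj p) = proj (X p)) (hY : ∀ p ∈ U, T' (proj p) = proj (Y p))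
      (p : J20) (hp : p ∈ U) :
      fderiv ℝ T' (proj p) (T (proj p)) = proj (fderiv ℝ Y p (X p)) := by
    have hd := (T'.differentiableAt (proj_mem_projOpens hp)).hasFDerivAt
    have h1 : HasFDerivAt (fun q => T' (proj q))
        ((fderiv ℝ T' (proj p)).comp (LinearMap.toContinuousLinearMap proj)) p :=
      HasFDerivAt.comp p hd (LinearMap.toContinuousLinearMap proj).hasFDerivAt
    have h2 : HasFDerivAt (fun q => proj (Y q))
        ((LinearMap.toContinuousLinearMap proj).comp (fderiv ℝ Y p)) p :=
      (LinearMap.toContinuousLinearMap proj).hasFDerivAt.comp p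
        (Y.differentiableAt hp).hasFDerivAt
    have h3 := h1.unique (h2.congr_of_eventuallyEq
      (Filter.eventuallyEq_of_mem (U.isOpen.mem_nhds hp) hY))
    rw [hX p hp]
    exact congrArg (fun L : J20 →L[ℝ] J2 => L (X p)) h3
  intro p hp
  rw [SmoothVectorField.bracket_apply _ _ (proj_mem_projOpens hp),
    SmoothVectorField.bracket_apply _ _ hp, lieBracket, lieBracket, map_sub,
    key hX hY p hp, key hY hX p hp]

theorem totalDeriv_affine (a b c : ℝ) (q : J2) :
    totalDeriv (fun q => a * q 0 + b * q 1 + c) q = a + b * q 2 := by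
  have h (i : Fin 4) : HasFDerivAt (fun q : J2 => q i)
      (ContinuousLinearMap.proj (R := ℝ) (φ := fun _ : Fin 4 => ℝ) i) q := hasFDerivAt_apply i q
  have hd : HasFDerivAt (fun q : J2 => a * q 0 + b * q 1 + c) _ q :=
    (((h 0).const_mul a).add ((h 1).const_mul b)).add_const c
  rw [totalDeriv, hd.fderiv]
  simp

theorem totalDeriv_quadratic (a b c : ℝ) (q : J2) :
    totalDeriv (fun q => a + b * q 2 + c * q 2 ^ 2) q = (b + 2 * c * q 2) * q 3 := by
  have h : HasFDerivAt (fun q : J2 => q 2)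
      (ContinuousLinearMap.proj (R := ℝ) (φ := fun _ : Fin 4 => ℝ) 2) q := hasFDerivAt_apply 2 q
  have hd : HasFDerivAt (fun q : J2 => a + b * q 2 + c * q 2 ^ 2) _ q :=
    ((h.const_mul b).const_add a).add ((h.pow 2).const_mul c)
  rw [totalDeriv, hd.fderiv]
  simp
  ring

/-- For affine v both D_xξ and D_xη are affine in y₁, so η₁ is a quadratic polynomial in y₁ and η₂
is y₂ times an affine one. The value of t is free because S₆ projects to zero. -/
theorem prolongation_affine {v : Plane → Plane} {A : Matrix (Fin 2) (Fin 2) ℝ} {b : Plane}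
    (hA : A.trace = 0) (hv : ∀ p, v p = A.mulVec p + b) (t : ℝ) :
    prolongation v = projField ![A 1 0, A 0 0, A 0 1, b 0, b 1, t] := by
  have h11 : A 1 1 = -A 0 0 := by
    rw [Matrix.trace_fin_two] at hA
    linarith
  have h0 (q : J2) : v ![q 0, q 1] 0 = A 0 0 * q 0 + A 0 1 * q 1 + b 0 := by
    rw [hv]; simp
  have h1 (q : J2) : v ![q 0, q 1] 1 = A 1 0 * q 0 + A 1 1 * q 1 + b 1 := by
    rw [hv]; simp
  have h2 : (fun q : J2 => A 1 0 + A 1 1 * q 2 - q 2 * (A 0 0 + A 0 1 * q 2)) =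
      fun q => A 1 0 + (A 1 1 - A 0 0) * q 2 + -A 0 1 * q 2 ^ 2 := by
    funext q; ring
  funext q
  simp only [prolongation, h0, h1, totalDeriv_affine, h2, totalDeriv_quadratic]
  ext i
  fin_cases i <;> simp [projField, h11] <;> ring

end Fibration

/-! ### The projection homomorphism, its kernel and its image -/

section Projection

variable {U : Opens J20}

theorem exists_projection (hU : IsPreconnected (U : Set J20)) (hreg : ∀ p ∈ U, p 3 ≠ 0) :
    ∃ Φ : symmetryAlgebra mongeDistribution U →ₗ⁅ℝ⁆ SmoothVectorField (projOpens U),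
      ∀ X, ∀ p ∈ U, Φ X (proj p) = proj (X.1 p) := by
  have h (X : symmetryAlgebra mongeDistribution U) :
      ∃ T : SmoothVectorField (projOpens U), ∀ p ∈ U, T (proj p) = proj (X.1 p) := by
    obtain ⟨k, hk⟩ := (mem_symmetryAlgebra_iff hU hreg X.1).1 X.2
    refine ⟨restrict (projField k) (contDiff_projField k) (projOpens U), fun p hp => ?_⟩
    rw [hk, combS_apply k hp, proj_combField]
    exact indicator_of_mem (s := (projOpens U : Set J2)) (proj_mem_projOpens hp) (projField k)
  -- A projected field is determined by its values at the points π(p), p ∈ U, so the chosen fields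
  -- automatically respect sums, multiples and brackets.
  choose T hT using h
  refine ⟨{ toFun := T
            map_add' := fun X Y => ?_
            map_smul' := fun c X => ?_
            map_lie' := fun {X Y} => ?_ }, hT⟩
  · refine ext_projOpens fun p hp => ?_
    rw [SmoothVectorField.add_apply, hT _ p hp, hT _ p hp, hT _ p hp, ← map_add]
    rfl
  · refine ext_projOpens fun p hp => ?_
    rw [RingHom.id_apply, SmoothVectorField.smul_apply, hT _ p hp, hT _ p hp, ← map_smul]
    rfl
  · refine ext_projOpens fun p hp => ?_
    rw [proj_lie (hT X) (hT Y) p hp, hT _ p hp]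
    rfl

theorem combS_single (t : ℝ) : combS U (Pi.single 5 t) = t • S U 5 :=
  Fintype.linearCombination_apply_single ℝ (S U) 5 t

theorem eq_single_iff {k : Fin 6 → ℝ} : (∀ i ≠ 5, k i = 0) ↔ k = Pi.single 5 (k 5) := by
  constructor
  · intro h
    ext i
    by_cases hi : i = 5
    · rw [hi, Pi.single_eq_same]
    · rw [h i hi, Pi.single_eq_of_ne hi]
  · intro h i hi
    rw [h, Pi.single_eq_of_ne hi]

/-- Brackets with the translations S₄ and S₅ already detect every coefficient except that of S₆. -/
theorem combBracket_eq_zero_iff {l : Fin 6 → ℝ} :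
    (∀ k, combBracket k l = 0) ↔ ∀ i ≠ 5, l i = 0 := by
  constructor
  · intro h
    have h3 := h ![0, 0, 0, 1, 0, 0]
    have h4 := h ![0, 0, 0, 0, 1, 0]
    simp [combBracket] at h3 h4
    intro i hi
    fin_cases i
    · exact h3.2.1
    · exact h3.1
    · exact h4.1
    · exact h4.2.2
    · exact h3.2.2
    · exact absurd rfl hi
  · intro h k
    ext i
    fin_cases i <;> simp [combBracket, h]

variable (hU : IsConnected (U : Set J20)) (hreg : ∀ p ∈ U, p 3 ≠ 0)
include hU hreg

theorem finrank_symmetryAlgebra :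
    Module.finrank ℝ (symmetryAlgebra mongeDistribution U) = 6 := by
  change Module.finrank ℝ (symmetryAlgebra mongeDistribution U).toSubmodule = 6
  rw [symmetryAlgebra_toSubmodule hU.isPreconnected hreg,
    LinearMap.finrank_range_of_inj (combS_injective hU.nonempty hreg), Module.finrank_fin_fun]

theorem mem_center_iff {X : symmetryAlgebra mongeDistribution U} :
    X ∈ LieAlgebra.center ℝ (symmetryAlgebra mongeDistribution U) ↔
      X.1 ∈ Submodule.span ℝ {S U 5} := by
  have hmem (k : Fin 6 → ℝ) : combS U k ∈ symmetryAlgebra mongeDistribution U :=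
    (mem_symmetryAlgebra_iff hU.isPreconnected hreg _).2 ⟨k, rfl⟩
  have hinj := combS_injective hU.nonempty hreg
  obtain ⟨l, hl⟩ := (mem_symmetryAlgebra_iff hU.isPreconnected hreg X.1).1 X.2
  rw [LieModule.mem_maxTrivSubmodule, Submodule.mem_span_singleton]
  have h1 : (∀ Y : symmetryAlgebra mongeDistribution U, ⁅Y, X⁆ = 0) ↔
      ∀ k, combBracket k l = 0 := by
    constructor
    · intro h k
      apply hinj
      rw [← lie_combS, map_zero, ← hl]
      exact congrArg Subtype.val (h ⟨combS U k, hmem k⟩)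
    · intro h Y
      obtain ⟨k, hk⟩ := (mem_symmetryAlgebra_iff hU.isPreconnected hreg Y.1).1 Y.2
      refine Subtype.ext ?_
      change ⁅Y.1, X.1⁆ = 0
      rw [hk, hl, lie_combS, h k, map_zero]
  rw [h1, combBracket_eq_zero_iff, hl, eq_single_iff]
  constructor
  · intro h
    exact ⟨l 5, by rw [← combS_single, ← h]⟩
  · rintro ⟨a, ha⟩
    rw [← combS_single] at ha
    rw [← hinj ha, Pi.single_eq_same]

variable {Φ : symmetryAlgebra mongeDistribution U →ₗ⁅ℝ⁆ SmoothVectorField (projOpens U)}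
  (hΦ : ∀ X, ∀ p ∈ U, Φ X (proj p) = proj (X.1 p))
include hΦ

theorem mem_ker_projection_iff {X : symmetryAlgebra mongeDistribution U} :
    X ∈ Φ.ker ↔ X.1 ∈ Submodule.span ℝ {S U 5} := by
  rw [LieHom.mem_ker, Submodule.mem_span_singleton]
  constructor
  · intro h
    obtain ⟨k, hk⟩ := (mem_symmetryAlgebra_iff hU.isPreconnected hreg X.1).1 X.2
    have h5 := eq_single_iff.1 (coeff_eq_zero_of_combS hU.nonempty hreg (k := k) fun p hp => by
      rw [← hk, ← hΦ X p hp, h]; rfl)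
    exact ⟨k 5, by rw [hk, ← combS_single, ← h5]⟩
  · rintro ⟨a, ha⟩
    refine ext_projOpens fun p hp => ?_
    rw [hΦ X p hp, ← ha, ← combS_single, combS_apply _ hp, proj_combField]
    ext i
    fin_cases i <;> simp [projField]

theorem ker_projection :
    Φ.ker = LieAlgebra.center ℝ (symmetryAlgebra mongeDistribution U) := by
  ext X
  rw [mem_ker_projection_iff hU hreg hΦ, mem_center_iff hU hreg]

theorem map_ker_projection :
    Submodule.map (symmetryAlgebra mongeDistribution U).toSubmodule.subtype
      Φ.ker.toSubmodule = Submodule.span ℝ {S U 5} := by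
  ext X
  rw [Submodule.mem_map]
  constructor
  · rintro ⟨Y, hY, rfl⟩
    exact (mem_ker_projection_iff hU hreg hΦ).1 hY
  · intro hX
    obtain ⟨a, rfl⟩ := Submodule.mem_span_singleton.1 hX
    have hmem : a • S U 5 ∈ symmetryAlgebra mongeDistribution U :=
      (mem_symmetryAlgebra_iff hU.isPreconnected hreg _).2 ⟨_, (combS_single a).symm⟩
    exact ⟨⟨a • S U 5, hmem⟩, (mem_ker_projection_iff hU hreg hΦ).2 hX, rfl⟩

theorem finrank_ker_projection : Module.finrank ℝ Φ.ker = 1 := by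
  have h := map_ker_projection hU hreg hΦ
  have h0 : S U 5 ≠ 0 := (linearIndependent_S hU.nonempty hreg).ne_zero 5
  have e := Submodule.equivMapOfInjective
    (symmetryAlgebra mongeDistribution U).toSubmodule.subtype Subtype.val_injective
    Φ.ker.toSubmodule
  rw [← finrank_span_singleton (K := ℝ) h0, ← h]
  exact e.finrank_eq

theorem finrank_range_projection : Module.finrank ℝ Φ.range = 5 := by
  have h6 := finrank_symmetryAlgebra hU hreg
  have h1 := finrank_ker_projection hU hreg hΦ
  have : FiniteDimensional ℝ (symmetryAlgebra mongeDistribution U) :=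
    Module.finite_of_finrank_pos (by rw [h6]; norm_num)
  have h := LinearMap.finrank_range_add_finrank_ker
    (Φ : symmetryAlgebra mongeDistribution U →ₗ[ℝ] SmoothVectorField (projOpens U))
  have h1' : Module.finrank ℝ (LinearMap.ker
    (Φ : symmetryAlgebra mongeDistribution U →ₗ[ℝ] SmoothVectorField (projOpens U))) = 1 := h1
  rw [h6, h1'] at h
  exact Nat.succ_injective h

theorem mem_range_projection_iff (T : SmoothVectorField (projOpens U)) :
    T ∈ Φ.range ↔ ∃ v ∈ equiaffine, ∀ q ∈ projOpens U, T q = prolongation v q := by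
  rw [LieHom.mem_range]
  constructor
  · rintro ⟨X, rfl⟩
    obtain ⟨k, hk⟩ := (mem_symmetryAlgebra_iff hU.isPreconnected hreg X.1).1 X.2
    have hA : (!![k 1, k 2; k 0, -k 1] : Matrix (Fin 2) (Fin 2) ℝ).trace = 0 := by
      simp [Matrix.trace_fin_two]
    refine ⟨fun p => (!![k 1, k 2; k 0, -k 1] : Matrix (Fin 2) (Fin 2) ℝ).mulVec p +
      ![k 3, k 4], ⟨_, _, hA, fun _ => rfl⟩, fun q hq => ?_⟩
    obtain ⟨p, hp, rfl⟩ := exists_mem_of_mem_projOpens hq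
    rw [hΦ X p hp, hk, combS_apply k hp, proj_combField,
      prolongation_affine hA (fun _ => rfl) 0]
    rfl
  · rintro ⟨v, ⟨A, b, hA, hv⟩, hT⟩
    -- A preimage is unique only up to multiples of S₆; the last coefficient is taken to be 0.
    refine ⟨⟨combS U ![A 1 0, A 0 0, A 0 1, b 0, b 1, 0],
      (mem_symmetryAlgebra_iff hU.isPreconnected hreg _).2 ⟨_, rfl⟩⟩, ext_projOpens fun p hp => ?_⟩
    rw [hΦ _ p hp, hT _ (proj_mem_projOpens hp), prolongation_affine hA hv 0, combS_apply _ hp,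
      proj_combField]

end Projection

end Monge

end
theorem lemma2 (U : TopologicalSpace.Opens Monge.J20) (hU : IsConnected (U : Set Monge.J20))
    (hreg : ∀ p ∈ U, p 3 ≠ 0) :
    -- the distribution is a generic rank 2 distribution
    Monge.IsGeneric Monge.mongeDistribution U ∧
    -- `S₁, …, S₆` is a basis of the full symmetry algebra
    (Monge.symmetryAlgebra Monge.mongeDistribution U).toSubmodule =
      Submodule.span ℝ (Set.range (Monge.S U)) ∧
    LinearIndependent ℝ (Monge.S U) ∧
    -- the symmetry algebra is isomorphic to `sl(2) ⋉ n₃`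
    Nonempty (Monge.symmetryAlgebra Monge.mongeDistribution U ≃ₗ⁅ℝ⁆ Monge.Sl2N3) ∧
    -- it preserves the fibration
    Monge.symmetryAlgebra Monge.mongeDistribution U ≤ Monge.symmetryAlgebra Monge.vertical U ∧
    -- the projection `Φ = π_*` on the symmetry algebra, its kernel and its image
    ∃ Φ : Monge.symmetryAlgebra Monge.mongeDistribution U →ₗ⁅ℝ⁆
        Monge.SmoothVectorField (Monge.projOpens U),
      (∀ X, ∀ p ∈ U, (Φ X) (Monge.proj p) = Monge.proj (X.1 p)) ∧
      Φ.ker = LieAlgebra.center ℝ (Monge.symmetryAlgebra Monge.mongeDistribution U) ∧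
      Submodule.map (Monge.symmetryAlgebra Monge.mongeDistribution U).toSubmodule.subtype
        Φ.ker.toSubmodule = Submodule.span ℝ {Monge.S U 5} ∧
      Module.finrank ℝ Φ.ker = 1 ∧
      Module.finrank ℝ Φ.range = 5 ∧
      ∀ T : Monge.SmoothVectorField (Monge.projOpens U), T ∈ Φ.range ↔
        ∃ v ∈ Monge.equiaffine, ∀ q ∈ Monge.projOpens U, T q = Monge.prolongation v q := by
  obtain ⟨Φ, hΦ⟩ := Monge.exists_projection hU.isPreconnected hreg
  refine ⟨Monge.isGeneric_mongeDistribution hreg, ?_, Monge.linearIndependent_S hU.nonempty hreg,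
    Monge.nonempty_symmetryAlgebra_equiv hU hreg, ?_, Φ, hΦ, Monge.ker_projection hU hreg hΦ,
    Monge.map_ker_projection hU hreg hΦ, Monge.finrank_ker_projection hU hreg hΦ,
    Monge.finrank_range_projection hU hreg hΦ, Monge.mem_range_projection_iff hU hreg hΦ⟩
  · rw [Monge.symmetryAlgebra_toSubmodule hU.isPreconnected hreg, Monge.range_combS]
  · intro X hX
    obtain ⟨k, rfl⟩ := (Monge.mem_symmetryAlgebra_iff hU.isPreconnected hreg X).1 hX
    exact Monge.combS_mem_symmetryAlgebra_vertical k
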